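/- Let $N\ge 2$ be even, let $s\in\{\tfrac12,1,\tfrac32,\dots\}$, and put $\eta_\alpha=e^{2\pi i\alpha/N}$ for $\alpha=1,\dots,N$. Let $a_\alpha^\dagger,b_\alpha^\dagger$ ($\alpha=1,\dots,N$) be bosonic creation operators with vacuum $|0\rangle$. The spin chain lives on the space of all vectors of their Fock space with exactly $2s$ bosons $a_\alpha^\dagger a_\alpha+b_\alpha^\dagger b_\alpha=2s$ at each site $\alpha$; the spin-$s$ operators $\mathbf S_\alpha$ of site $\alpha$ are given by $S^x_\alpha+iS^y_\alpha=a_\alpha^\dagger b_\alpha$, $S^x_\alpha-iS^y_\alpha=b_\alpha^\dagger a_\alpha$, $S^z_\alpha=\tfrac12(a_\alpha^\dagger a_\alpha-b_\alpha^\dagger b_\alpha)$, and $\mathbf S_{\rm tot}=\sum_\alpha\mathbf S_\alpha$. Let $$|\psi_0^S\rangle=\big(\Psi^{\rm HS}_0[a^\dagger,b^\dagger]\big)^{2s}|0\rangle,\qquad \Psi_0^{\rm HS}[a^\dagger,b^\dagger]=\sum_{A\subset\{1,\dots,N\},\,|A|=N/2}\ \prod_{\alpha<\beta;\ \alpha,\beta\in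 A}(\eta_\alpha-\eta_\beta)^2\prod_{\alpha\in A}\eta_\alpha\ \prod_{\alpha\in A}a_\alpha^\dagger\prod_{\alpha\notin A}b_\alpha^\dagger .$$ Write $\omega_{\alpha\beta\gamma}=\dfrac{1}{(\bar\eta_\alpha-\bar\eta_\beta)(\eta_\alpha-\eta_\gamma)}$, so that $\omega_{\alpha\beta\beta}=1/|\eta_\alpha-\eta_\beta|^2$, and $\mathbf S_\alpha\mathbf S_\beta$ for the scalar product; products of operators are taken in the order written. Define the vector operators $$\mathbf D_\alpha^S=\frac12\sum_{\beta\ne\alpha}\frac{\eta_\alpha+\eta_\beta}{\eta_\alpha-\eta_\beta}\Big[i(\mathbf S_\alpha\times\mathbf S_\beta)+(s+1)\mathbf S_\beta-\frac{1}{s+1}\mathbf S_\alpha(\mathbf S_\alpha\mathbf S_\beta)\Big],$$ $$\begin{aligned}\mathbf A_\alpha^S&=\sum_{\beta\ne\alpha}\frac{\mathbf S_\alpha(\mathbf S_\alpha\mathbf S_\beta)+(\mathbf S_\alpha\mathbf S_\beta)\mathbf S_\alpha+2(s+1)\mathbf S_\beta}{|\eta_\alpha-\eta_\beta|^2}\\&\quad+\sum_{\beta,\gamma\ne\alpha}\omega_{\alpha\beta\gamma}\Big[-\frac{(\mathbf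 S_\alpha\mathbf S_\beta)\mathbf S_\alpha(\mathbf S_\alpha\mathbf S_\gamma)+(\mathbf S_\alpha\mathbf S_\gamma)\mathbf S_\alpha(\mathbf S_\alpha\mathbf S_\beta)}{s+1}+2(s+2)\mathbf S_\alpha(\mathbf S_\beta\mathbf S_\gamma)-\mathbf S_\beta(\mathbf S_\alpha\mathbf S_\gamma)-(\mathbf S_\alpha\mathbf S_\beta)\mathbf S_\gamma\Big],\end{aligned}$$ where $\beta=\gamma$ is allowed in the double sum, $$\mathbf\Lambda^S=\frac12\sum_{\alpha\ne\beta}\frac{\eta_\alpha+\eta_\beta}{\eta_\alpha-\eta_\beta}\Big[i(\mathbf S_\alpha\times\mathbf S_\beta)-\frac{1}{s+1}\mathbf S_\alpha(\mathbf S_\alpha\mathbf S_\beta)\Big],$$ $$\begin{aligned}\mathbf\Upsilon^S&=-\frac1{s+1}\sum_{\alpha}\sum_{\beta,\gamma\ne\alpha}\omega_{\alpha\beta\gamma}\big[(\mathbf S_\alpha\mathbf S_\beta)\mathbf S_\alpha(\mathbf S_\alpha\mathbf S_\gamma)+(\mathbf S_\alpha\mathbf S_\gamma)\mathbf S_\alpha(\mathbf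 S_\alpha\mathbf S_\beta)\big]\\&\quad+\sum_{\alpha,\beta,\gamma\ \text{pairwise distinct}}\omega_{\alpha\beta\gamma}\big[2(s+2)\mathbf S_\alpha(\mathbf S_\beta\mathbf S_\gamma)-\mathbf S_\beta(\mathbf S_\alpha\mathbf S_\gamma)-(\mathbf S_\alpha\mathbf S_\beta)\mathbf S_\gamma\big],\end{aligned}$$ and the Hamiltonian and energy $$H^S=\frac{2\pi^2}{N^2}\Big[\sum_{\alpha\ne\beta}\frac{\mathbf S_\alpha\mathbf S_\beta}{|\eta_\alpha-\eta_\beta|^2}-\frac{1}{2(s+1)(2s+3)}\sum_{\alpha}\sum_{\beta,\gamma\ne\alpha}\omega_{\alpha\beta\gamma}\big[(\mathbf S_\alpha\mathbf S_\beta)(\mathbf S_\alpha\mathbf S_\gamma)+(\mathbf S_\alpha\mathbf S_\gamma)(\mathbf S_\alpha\mathbf S_\beta)\big]\Big],$$ $$E_0^S=-\frac{2\pi^2}{N^2}\,\frac{s(s+1)^2}{2s+3}\,\frac{N(N^2+5)}{12}.$$ Then: 1. All components of $\mathbf D_\alpha^S$ and of $\mathbf A_\alpha^S$ annihilate $|\psi_0^S\rangle$,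 for every $\alpha$. 2. $\sum_\alpha\mathbf D_\alpha^S=\mathbf\Lambda^S$, and $\mathbf\Lambda^S|\psi_0^S\rangle=0$. 3. $\sum_\alpha\mathbf A_\alpha^S=\mathbf\Upsilon^S+(s+1)^3\,\frac{N^2-1}{6}\,\mathbf S_{\rm tot}$, and $\mathbf\Upsilon^S|\psi_0^S\rangle=0$. 4. As operators on the spin chain, $$\frac{2\pi^2}{N^2}\Big[\frac{1}{2s(s+2)(2s+3)}\sum_\alpha\mathbf S_\alpha\mathbf A_\alpha^S+\frac{s+1}{2(2s+3)}\mathbf S_{\rm tot}^2\Big]=H^S-E_0^S .$$ -/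

import Mathlib

noncomputable section

namespace SpinChain

open MvPolynomial

/-! Schwinger boson Fock space of `N` sites with modes `a_α` (index `(α, true)`) and `b_α`
(index `(α, false)`). A vector is written as the polynomial in the creation operators that produces
it from the vacuum `|0⟩ = 1`; creation is multiplication by a variable, annihilation is the
partial derivative. -/

/-- Finite-particle Fock space of the Schwinger bosons on `N` sites. -/
abbrev Fock (N : ℕ) : Type := MvPolynomial (Fin N × Bool) ℂ

/-- Creation operator of the mode `j`. -/
def create {N : ℕ} (j : Fin N × Bool) : Module.End ℂ (Fock N) :=
  LinearMap.mulLeft ℂ (X j : Fock N)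

/-- Annihilation operator of the mode `j`. -/
def annihilate {N : ℕ} (j : Fin N × Bool) : Module.End ℂ (Fock N) :=
  (pderiv j).toLinearMap

/-- Number of bosons at the site `α`: `a†a + b†b`. -/
def bosonNumber {N : ℕ} (α : Fin N) : Module.End ℂ (Fock N) :=
  create (α, true) * annihilate (α, true) + create (α, false) * annihilate (α, false)

/-- `S = ½ (a†, b†) σ (a, b)ᵀ` at the site `α`; the components `0, 1, 2` are `x, y, z`. -/
def fockSpin {N : ℕ} (α : Fin N) : Fin 3 → Module.End ℂ (Fock N) :=
  ![(1 / 2 : ℂ) • (create (α, true) * annihilate (α, false)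
      + create (α, false) * annihilate (α, true)),
    (-Complex.I / 2) • (create (α, true) * annihilate (α, false)
      - create (α, false) * annihilate (α, true)),
    (1 / 2 : ℂ) • (create (α, true) * annihilate (α, true)
      - create (α, false) * annihilate (α, false))]

/-- State space of the spin chain with spin `s = k / 2` on each of the `N` sites: the vectors
with exactly `k = 2s` bosons on every site. -/
def SpinSpace (N k : ℕ) : Submodule ℂ (Fock N) :=
  ⨅ α : Fin N, Module.End.eigenspace (bosonNumber α) (k : ℂ)

theorem mem_spinSpace {N k : ℕ} {p : Fock N} :
    p ∈ SpinSpace N k ↔ ∀ α, bosonNumber α p = (k : ℂ) • p := by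
  simp [SpinSpace, Submodule.mem_iInf]

theorem bosonNumber_apply {N : ℕ} (α : Fin N) (p : Fock N) :
    bosonNumber α p
      = X (α, true) * pderiv (α, true) p + X (α, false) * pderiv (α, false) p := rfl

theorem pderiv_comm' {N : ℕ} (i j : Fin N × Bool) (p : Fock N) :
    pderiv i (pderiv j p) = pderiv j (pderiv i p) := by
  have h : ⁅(pderiv i : Derivation ℂ (Fock N) (Fock N)),
      (pderiv j : Derivation ℂ (Fock N) (Fock N))⁆ = 0 := by
    apply MvPolynomial.derivation_ext
    intro l
    rw [Derivation.commutator_apply]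
    simp only [pderiv_X, Pi.single_apply]
    split_ifs <;> simp
  have := congrArg (fun d : Derivation ℂ (Fock N) (Fock N) => d p) h
  simp only [Derivation.commutator_apply] at this
  exact sub_eq_zero.mp this

theorem bosonNumber_hop {N : ℕ} (α β : Fin N) (c d : Bool) :
    Commute (bosonNumber α) (create (β, c) * annihilate (β, d)) := by
  apply LinearMap.ext
  intro p
  change X (α, true) * pderiv (α, true) (X (β, c) * pderiv (β, d) p)
      + X (α, false) * pderiv (α, false) (X (β, c) * pderiv (β, d) p)
    = X (β, c) * pderiv (β, d) (X (α, true) * pderiv (α, true) p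
        + X (α, false) * pderiv (α, false) p)
  simp only [map_add, Derivation.leibniz, smul_eq_mul, pderiv_X, Pi.single_apply,
    pderiv_comm' (β, d) (α, true), pderiv_comm' (β, d) (α, false), Prod.mk.injEq]
  by_cases h : α = β
  · subst h
    cases c <;> cases d <;> simp <;> ring
  · simp [h, Ne.symm h]
    ring

theorem bosonNumber_fockSpin {N : ℕ} (α β : Fin N) (i : Fin 3) :
    Commute (bosonNumber α) (fockSpin β i) := by
  fin_cases i
  · exact ((bosonNumber_hop α β _ _).add_right (bosonNumber_hop α β _ _)).smul_right _
  · exact ((bosonNumber_hop α β _ _).sub_right (bosonNumber_hop α β _ _)).smul_right _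
  · exact ((bosonNumber_hop α β _ _).sub_right (bosonNumber_hop α β _ _)).smul_right _

theorem fockSpin_mem {N k : ℕ} (α : Fin N) (i : Fin 3) :
    ∀ p ∈ SpinSpace N k, fockSpin α i p ∈ SpinSpace N k := by
  intro p hp
  rw [mem_spinSpace] at hp ⊢
  intro β
  have h := LinearMap.congr_fun (bosonNumber_fockSpin β α i).eq p
  simp only [Module.End.mul_apply] at h
  rw [h, hp β, map_smul]

/-- Component `i` of the spin operator of the site `α`, acting on the spin chain. -/
def spin {N k : ℕ} (α : Fin N) (i : Fin 3) : Module.End ℂ (SpinSpace N k) :=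
  (fockSpin α i).restrict (fockSpin_mem α i)

/-- Coordinates `η_α = exp (2πi α / N)`, where the sites `0, …, N - 1` of `Fin N` stand for
`α = 1, …, N`. -/
def eta {N : ℕ} (α : Fin N) : ℂ :=
  Complex.exp (2 * (Real.pi : ℂ) * Complex.I * ((α : ℕ) + 1 : ℂ) / (N : ℂ))

/-- Haldane–Shastry wave function `∏_{i<j} (z_i - z_j)² ∏_i z_i` of the configuration with up
spins on the sites in `A`. -/
def hsWave {N : ℕ} (A : Finset (Fin N)) : ℂ :=
  (∏ i ∈ A, ∏ j ∈ A with i < j, (eta i - eta j) ^ 2) * ∏ i ∈ A, eta i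

/-- `Ψ^HS[a†, b†]`: the sum over the configurations of `N / 2` up spins on the chain. -/
def hsPoly (N : ℕ) : Fock N :=
  ∑ A ∈ (Finset.univ : Finset (Fin N)).powersetCard (N / 2),
    hsWave A • ((∏ α ∈ A, X (α, true)) * ∏ α ∈ Aᶜ, X (α, false))

theorem bosonNumber_mul {N : ℕ} (α : Fin N) (p q : Fock N) :
    bosonNumber α (p * q) = bosonNumber α p * q + p * bosonNumber α q := by
  simp only [bosonNumber_apply, Derivation.leibniz, smul_eq_mul]
  ring

theorem bosonNumber_X {N : ℕ} (α β : Fin N) (c : Bool) :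
    bosonNumber α (X (β, c) : Fock N) = if α = β then X (β, c) else 0 := by
  simp only [bosonNumber_apply, pderiv_X, Pi.single_apply, Prod.mk.injEq]
  by_cases h : α = β
  · subst h
    cases c <;> simp
  · simp [h, Ne.symm h]

theorem bosonNumber_prod {N : ℕ} (α : Fin N) (c : Bool) (A : Finset (Fin N)) :
    bosonNumber α (∏ β ∈ A, X (β, c) : Fock N) =
      if α ∈ A then ∏ β ∈ A, X (β, c) else 0 := by
  induction A using Finset.induction_on with
  | empty => simp [bosonNumber_apply]
  | insert β A hβ ih =>
    rw [Finset.prod_insert hβ, bosonNumber_mul, ih, bosonNumber_X]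
    by_cases h : α = β
    · subst h
      simp [hβ]
    · simp [h]

theorem hsPoly_mem {N : ℕ} : hsPoly N ∈ SpinSpace N 1 := by
  rw [mem_spinSpace]
  intro α
  rw [hsPoly, map_sum, Nat.cast_one, one_smul]
  refine Finset.sum_congr rfl fun A _ => ?_
  rw [map_smul, bosonNumber_mul, bosonNumber_prod, bosonNumber_prod]
  by_cases h : α ∈ A <;> simp [h]

theorem hsPoly_pow_mem {N : ℕ} (k : ℕ) : hsPoly N ^ k ∈ SpinSpace N k := by
  rw [mem_spinSpace]
  intro α
  have h1 : bosonNumber α (hsPoly N) = hsPoly N := by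
    simpa using mem_spinSpace.mp hsPoly_mem α
  induction k with
  | zero => simp [bosonNumber_apply]
  | succ k ih =>
    rw [pow_succ, bosonNumber_mul, ih, h1, Nat.cast_succ, add_smul, one_smul, smul_mul_assoc]

/-- The spin liquid state `|ψ^S_0⟩ = (Ψ^HS[a†, b†])^(2s) |0⟩` with `2s = k`. -/
def groundState (N k : ℕ) : SpinSpace N k :=
  ⟨hsPoly N ^ k, hsPoly_pow_mem k⟩

/-! Scalar and vector products of vector operators, with the order of the factors kept. -/

/-- `A · B = ∑ i, A i * B i`. -/
def dot {R : Type*} [Ring R] (A B : Fin 3 → R) : R := ∑ i, A i * B i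

/-- `(A × B) i = ε_{ijk} A j * B k`. -/
def cross {R : Type*} [Ring R] (A B : Fin 3 → R) : Fin 3 → R :=
  fun i => A (i + 1) * B (i + 2) - A (i + 2) * B (i + 1)

/-- The spin quantum number `s = k / 2`. -/
def qn (k : ℕ) : ℂ := (k : ℂ) / 2

/-- `ω_{αβγ} = 1 / ((conj η_α - conj η_β) (η_α - η_γ))`. -/
def omega {N : ℕ} (α β γ : Fin N) : ℂ :=
  1 / ((starRingEnd ℂ (eta α) - starRingEnd ℂ (eta β)) * (eta α - eta γ))

/-- `1 / |η_α - η_β|²`. -/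
def invDistSq {N : ℕ} (α β : Fin N) : ℂ := ((1 / ‖eta α - eta β‖ ^ 2 : ℝ) : ℂ)

/-- Scalar product `S_α · S_β`. -/
def spinDot {N k : ℕ} (α β : Fin N) : Module.End ℂ (SpinSpace N k) :=
  dot (spin α) (spin β)

/-- Total spin. -/
def totalSpin {N k : ℕ} (i : Fin 3) : Module.End ℂ (SpinSpace N k) :=
  ∑ α : Fin N, spin α i

/-- The vector operator `D_α^S`. -/
def opD {N k : ℕ} (α : Fin N) (i : Fin 3) : Module.End ℂ (SpinSpace N k) :=
  (1 / 2 : ℂ) • ∑ β ∈ Finset.univ.erase α, ((eta α + eta β) / (eta α - eta β)) •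
    (Complex.I • cross (spin α) (spin β) i + (qn k + 1) • spin β i
      - (1 / (qn k + 1)) • (spin α i * spinDot α β))

/-- The vector operator `Λ^S`. -/
def opLambda {N k : ℕ} (i : Fin 3) : Module.End ℂ (SpinSpace N k) :=
  (1 / 2 : ℂ) • ∑ α : Fin N, ∑ β ∈ Finset.univ.erase α,
    ((eta α + eta β) / (eta α - eta β)) •
      (Complex.I • cross (spin α) (spin β) i - (1 / (qn k + 1)) • (spin α i * spinDot α β))

/-- `(S_α·S_β) S_α (S_α·S_γ) + (S_α·S_γ) S_α (S_α·S_β)`. -/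
def fiveSpin {N k : ℕ} (α β γ : Fin N) (i : Fin 3) : Module.End ℂ (SpinSpace N k) :=
  spinDot α β * spin α i * spinDot α γ + spinDot α γ * spin α i * spinDot α β

/-- `2(s+2) S_α (S_β·S_γ) - S_β (S_α·S_γ) - (S_α·S_β) S_γ`. -/
def threeSpin {N k : ℕ} (α β γ : Fin N) (i : Fin 3) : Module.End ℂ (SpinSpace N k) :=
  (2 * (qn k + 2)) • (spin α i * spinDot β γ) - spin β i * spinDot α γ
    - spinDot α β * spin γ i

/-- The vector operator `A_α^S`; in the double sum `β = γ` is allowed. -/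
def opA {N k : ℕ} (α : Fin N) (i : Fin 3) : Module.End ℂ (SpinSpace N k) :=
  (∑ β ∈ Finset.univ.erase α, invDistSq α β •
    (spin α i * spinDot α β + spinDot α β * spin α i + (2 * (qn k + 1)) • spin β i))
  + ∑ β ∈ Finset.univ.erase α, ∑ γ ∈ Finset.univ.erase α, omega α β γ •
      (-((1 / (qn k + 1)) • fiveSpin α β γ i) + threeSpin α β γ i)

/-- The vector operator `Υ^S`: `β = γ` is allowed in the first sum, while `α, β, γ` are
pairwise distinct in the second one. -/
def opUpsilon {N k : ℕ} (i : Fin 3) : Module.End ℂ (SpinSpace N k) :=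
  -((1 / (qn k + 1)) • ∑ α : Fin N, ∑ β ∈ Finset.univ.erase α, ∑ γ ∈ Finset.univ.erase α,
      omega α β γ • fiveSpin α β γ i)
  + ∑ α : Fin N, ∑ β ∈ Finset.univ.erase α, ∑ γ ∈ (Finset.univ.erase α).erase β,
      omega α β γ • threeSpin α β γ i

/-- The Hamiltonian `H^S`; in the triple sum `β = γ` is allowed. -/
def hamiltonian (N k : ℕ) : Module.End ℂ (SpinSpace N k) :=
  (2 * (Real.pi : ℂ) ^ 2 / (N : ℂ) ^ 2) •
    ((∑ α : Fin N, ∑ β ∈ Finset.univ.erase α, invDistSq α β • spinDot α β)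
    - (1 / (2 * (qn k + 1) * (2 * qn k + 3))) •
      ∑ α : Fin N, ∑ β ∈ Finset.univ.erase α, ∑ γ ∈ Finset.univ.erase α,
        omega α β γ • (spinDot α β * spinDot α γ + spinDot α γ * spinDot α β))

/-- The energy `E_0^S = -(2π²/N²) (s(s+1)²/(2s+3)) (N(N²+5)/12)`. -/
def groundEnergy (N k : ℕ) : ℂ :=
  -(2 * (Real.pi : ℂ) ^ 2 / (N : ℂ) ^ 2) * (qn k * (qn k + 1) ^ 2 / (2 * qn k + 3))
    * ((N : ℂ) * ((N : ℂ) ^ 2 + 5) / 12)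

end SpinChain

end

/-!
Lowering spins of `Ψ^HS` produces polynomials in the coordinates of the up spins whose weighted
sums over the sites are geometric sums of roots of unity. Hence `Ψ^HS` is a singlet, and the field
`∑_{β ≠ α} c_β S_β` with `c_β = 1 / (η_α - η_β)` acts on it like `S_α` acts on some vector `g` with
one boson at `α`. The complex conjugate coefficients and `(η_α + η_β) / (η_α - η_β)` are
combinations of `c_β` and the constant `1` with coefficients depending only on `α`, so their fields
have the same property.

By the Leibniz rule such a field sends `(Ψ^HS)^(2s)` to a multiple of `(Ψ^HS)^(2s-1) S_α g`, on
which the projection of `S_α` coupled to the field onto total angular momentum `s + 1` vanishes.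
The operator `D_α` is this projection, and `A_α` is a sum of two terms in which it stands on the
right. The scalar product `S_α · A_α` is computed from the spin commutation relations alone; summed
over `α` it becomes `H - E_0` through the sums of `1 / |η_α - η_β|²` and of `ω_{αβγ}` over `α`.
-/

noncomputable section

namespace SpinChain

/-! ### Vector operators -/

section VectorOperators

variable {R : Type*} [Ring R]

theorem sum_fin_three_cyclic {M : Type*} [AddCommMonoid M] (f : Fin 3 → M) (i : Fin 3) :
    ∑ j, f j = f i + f (i + 1) + f (i + 2) := by
  fin_cases i <;> simp [Fin.sum_univ_three] <;> abel

theorem fin_three_add (i : Fin 3) :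
    i + 1 + 1 = i + 2 ∧ i + 1 + 2 = i ∧ i + 2 + 1 = i ∧ i + 2 + 2 = i + 1 := by
  fin_cases i <;> exact ⟨rfl, rfl, rfl, rfl⟩

theorem dot_add_right (A B C : Fin 3 → R) : dot A (B + C) = dot A B + dot A C := by
  simp [dot, mul_add, Finset.sum_add_distrib]

theorem dot_sub_right (A B C : Fin 3 → R) : dot A (B - C) = dot A B - dot A C := by
  simp [dot, mul_sub, Finset.sum_sub_distrib]

theorem dot_mul_const (A B : Fin 3 → R) (c : R) : dot A (fun i => B i * c) = dot A B * c := by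
  simp [dot, mul_assoc, Finset.sum_mul]

theorem dot_comm {A B : Fin 3 → R} (h : ∀ i, Commute (A i) (B i)) : dot A B = dot B A :=
  Finset.sum_congr rfl fun i _ => (h i).eq

theorem dot_cross (A B C : Fin 3 → R) : dot A (cross B C) = dot (cross A B) C := by
  obtain ⟨e1, e2, e3, e4⟩ := fin_three_add 0
  simp only [dot, cross, sum_fin_three_cyclic _ 0, e1, e2, e3, e4, mul_sub, sub_mul, mul_assoc]
  abel

theorem cross_add_right (A B C : Fin 3 → R) : cross A (B + C) = cross A B + cross A C := by
  funext i
  simp only [cross, Pi.add_apply, mul_add]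
  abel

theorem cross_sub_right (A B C : Fin 3 → R) : cross A (B - C) = cross A B - cross A C := by
  funext i
  simp only [cross, Pi.sub_apply, mul_sub]
  abel

theorem cross_mul_const (A B : Fin 3 → R) (c : R) (i : Fin 3) :
    cross A (fun j => B j * c) i = cross A B i * c := by
  simp only [cross, mul_assoc, sub_mul]

theorem cross_anticomm {A B : Fin 3 → R} (h : ∀ i j, Commute (A i) (B j)) :
    cross A B = -cross B A := by
  funext i
  simp only [cross, Pi.neg_apply, (h _ _).eq, neg_sub]

theorem cross_cross {U S : Fin 3 → R} (h : ∀ i j, Commute (S i) (U j)) (W : Fin 3 → R)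
    (i : Fin 3) :
    cross U (cross S W) i = S i * dot U W - dot S U * W i := by
  obtain ⟨e1, e2, e3, e4⟩ := fin_three_add i
  simp only [cross, dot, sum_fin_three_cyclic _ i, e1, e2, e3, e4, mul_sub, mul_add, add_mul,
    ← mul_assoc, (h _ _).eq]
  abel

variable [Algebra ℂ R]

theorem dot_smul_left (c : ℂ) (A B : Fin 3 → R) : dot (c • A) B = c • dot A B := by
  simp [dot, Finset.smul_sum]

theorem dot_smul_right (c : ℂ) (A B : Fin 3 → R) : dot A (c • B) = c • dot A B := by
  simp [dot, Finset.smul_sum]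

theorem cross_smul_right (c : ℂ) (A B : Fin 3 → R) : cross A (c • B) = c • cross A B := by
  funext i
  simp [cross, smul_sub]

/-- The commutation relations `[U j, W k] = i ε_{jkl} V l` between the components of two vector
operators. -/
structure IsVectorBracket (U W V : Fin 3 → R) : Prop where
  commute_same : ∀ i, Commute (U i) (W i)
  bracket_pos : ∀ i, U (i + 1) * W (i + 2) - W (i + 2) * U (i + 1) = Complex.I • V i
  bracket_neg : ∀ i, U (i + 2) * W (i + 1) - W (i + 1) * U (i + 2) = -(Complex.I • V i)

/-- A vector operator `S` with the commutation relations of a spin and `S · S = s (s + 1)`. -/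
structure IsSpin (s : ℂ) (S : Fin 3 → R) : Prop extends IsVectorBracket S S S where
  casimir : dot S S = (s * (s + 1)) • (1 : R)

namespace IsVectorBracket

variable {U W V : Fin 3 → R}

theorem symm (h : IsVectorBracket U W V) : IsVectorBracket W U V where
  commute_same i := (h.commute_same i).symm
  bracket_pos i := by rw [← neg_sub, h.bracket_neg, neg_neg]
  bracket_neg i := by rw [← neg_sub, h.bracket_pos]

theorem cross_add_cross (h : IsVectorBracket U W V) :
    cross U W + cross W U = (2 * Complex.I) • V := by
  funext i
  simp only [Pi.add_apply, Pi.smul_apply, cross]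
  linear_combination (norm := module) h.bracket_pos i - h.bracket_neg i

theorem dot_cross_add_dot_cross {S : Fin 3 → R} (h : IsVectorBracket U W V)
    (hSU : ∀ i j, Commute (S i) (U j)) (hSW : ∀ i j, Commute (S i) (W j)) :
    dot U (cross S W) + dot W (cross S U) = (-2 * Complex.I) • dot S V := by
  have hneg (A B : Fin 3 → R) : dot (-A) B = -dot A B := by simp [dot]
  have hswap : ∀ {A B : Fin 3 → R}, (∀ i j, Commute (S i) (A j)) →
      dot A (cross S B) = -dot S (cross A B) := fun hA => by
    rw [dot_cross, cross_anticomm fun i j => (hA j i).symm, hneg, ← dot_cross]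
  rw [hswap hSU, hswap hSW, ← neg_add, ← dot_add_right, h.cross_add_cross, dot_smul_right,
    neg_mul, neg_smul]

theorem mul_dot {T : Fin 3 → R} (h : IsVectorBracket U W V)
    (hT : ∀ i j, Commute (U i) (T j)) (i : Fin 3) :
    U i * dot T W = dot T W * U i + Complex.I • cross T V i := by
  obtain ⟨e1, e2, e3, e4⟩ := fin_three_add i
  have h1 := h.bracket_pos (i + 2)
  have h2 := h.bracket_neg (i + 1)
  rw [e3, e4, sub_eq_iff_eq_add] at h1
  rw [e1, e2, sub_eq_iff_eq_add] at h2
  have hmove (j : Fin 3) : U i * (T j * W j) = T j * (U i * W j) := by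
    rw [← mul_assoc, (hT i j).eq, mul_assoc]
  simp only [dot, cross, sum_fin_three_cyclic _ i, mul_add, add_mul, hmove, mul_assoc,
    (h.commute_same i).eq]
  simp only [h1, h2, mul_add, mul_neg, mul_smul_comm, smul_sub]
  abel

end IsVectorBracket

/-- `2s + 1` times the projection of the vector operator `W` to total angular momentum `s + 1`,
where `S` is a spin `s` commuting with `W`. -/
def topProj (s : ℂ) (S W : Fin 3 → R) : Fin 3 → R :=
  Complex.I • cross S W + (s + 1) • W - (1 / (s + 1)) • fun i => S i * dot S W

/-- The vector operator through which a spin `S` couples to the fields `U` and `W`, where `V` is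
the bracket of `U` and `W`; the operators `A_α^S` are of this form. -/
def quadField (s : ℂ) (S U W V : Fin 3 → R) : Fin 3 → R := fun i =>
  (S i * dot S V + dot S V * S i + (2 * (s + 1)) • V i)
    + (-((1 / (s + 1)) • (dot S U * S i * dot S W + dot S W * S i * dot S U))
      + ((2 * (s + 2)) • (S i * dot U W) - U i * dot S W - dot S U * W i))

theorem IsVectorBracket.mul_dot_topProj_sub_cross {S U : Fin 3 → R}
    (hS : IsVectorBracket S S S) (hSU : ∀ i j, Commute (S i) (U j)) (s : ℂ) (W : Fin 3 → R)
    (i : Fin 3) :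
    S i * dot U (topProj s S W) - Complex.I • cross U (topProj s S W) i
      = Complex.I • (S i * dot U (cross S W)) + (s + 2) • (S i * dot U W) - dot S U * W i
        - (Complex.I * (s + 1)) • cross U W i
        - (1 / (s + 1)) • (dot S U * S i * dot S W) := by
  have hmove := hS.mul_dot hSU i
  rw [← dot_comm fun i => hSU i i] at hmove
  simp only [topProj, dot_add_right, dot_sub_right, dot_smul_right, dot_mul_const,
    cross_add_right, cross_sub_right, cross_smul_right, Pi.add_apply, Pi.sub_apply, Pi.smul_apply,
    cross_mul_const, cross_cross hSU, mul_add, mul_sub, mul_smul_comm, smul_add, smul_sub,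
    smul_smul, Complex.I_mul_I]
  rw [← dot_comm fun i => hSU i i, ← mul_assoc (S i) (dot S U), hmove, add_mul, smul_mul_assoc]
  module

theorem IsVectorBracket.quadField_eq {S U W V : Fin 3 → R} (hS : IsVectorBracket S S S)
    (hUW : IsVectorBracket U W V) (hSU : ∀ i j, Commute (S i) (U j))
    (hSW : ∀ i j, Commute (S i) (W j)) (hSV : ∀ i j, Commute (S i) (V j)) (s : ℂ) (i : Fin 3) :
    quadField s S U W V i
      = (S i * dot U (topProj s S W) - Complex.I • cross U (topProj s S W) i)
        + (S i * dot W (topProj s S U) - Complex.I • cross W (topProj s S U) i) := by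
  rw [hS.mul_dot_topProj_sub_cross hSU, hS.mul_dot_topProj_sub_cross hSW,
    dot_comm fun i => (hUW.commute_same i).symm]
  have hUcross := congrFun hUW.cross_add_cross i
  have hSdot := congrArg (S i * ·) (hUW.dot_cross_add_dot_cross hSU hSW)
  have hUmul := hUW.mul_dot (fun i j => (hSU j i).symm) i
  have hVmul := hS.mul_dot hSV i
  rw [← dot_comm fun i => hSV i i, cross_anticomm fun i j => (hSV j i).symm] at hVmul
  simp only [Pi.add_apply, Pi.smul_apply, Pi.neg_apply, mul_add, mul_smul_comm] at *
  rw [quadField]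
  linear_combination (norm := module) (-Complex.I) • hSdot + (Complex.I * (s + 1)) • hUcross
    - hUmul - hVmul + (2 * Complex.I_mul_I) • (S i * dot S V)
    + (2 * (s + 1) * Complex.I_mul_I) • V i

namespace IsSpin

variable {s : ℂ} {S U W V : Fin 3 → R}

theorem cross_self (hS : IsSpin s S) : cross S S = Complex.I • S := by
  have h := hS.cross_add_cross
  rw [← two_smul ℂ, mul_smul] at h
  exact smul_right_injective _ two_ne_zero h

theorem dot_cross_self (hS : IsSpin s S) (V : Fin 3 → R) :
    dot S (cross S V) = Complex.I • dot S V := by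
  rw [dot_cross, hS.cross_self, dot_smul_left]

theorem sum_mul_dot_mul (hS : IsSpin s S) (hSV : ∀ i j, Commute (S i) (V j)) :
    ∑ i, S i * dot S V * S i = (s * (s + 1) - 1) • dot S V := by
  have hmove (i : Fin 3) : dot S V * S i = S i * dot S V + Complex.I • cross S V i := by
    have h := hS.mul_dot hSV i
    rw [← dot_comm fun i => hSV i i, cross_anticomm fun i j => (hSV j i).symm] at h
    rw [h]
    simp
  calc ∑ i, S i * dot S V * S i
      = dot S S * dot S V + Complex.I • dot S (cross S V) := by
        simp only [mul_assoc, hmove, mul_add, mul_smul_comm, Finset.sum_add_distrib,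
          ← Finset.smul_sum]
        simp only [← mul_assoc, ← Finset.sum_mul, dot]
    _ = (s * (s + 1) - 1) • dot S V := by
        rw [hS.casimir, hS.dot_cross_self, smul_smul, Complex.I_mul_I, smul_one_mul, ← add_smul,
          sub_eq_add_neg]

theorem sum_mul_dot_mul_field (hS : IsSpin s S) (hUW : IsVectorBracket U W V)
    (hSW : ∀ i j, Commute (S i) (W j)) :
    ∑ i, S i * dot S U * W i = dot S W * dot S U + dot S V := by
  have hmove (i : Fin 3) : dot S U * W i = W i * dot S U - Complex.I • cross S V i :=
    eq_sub_of_add_eq (hUW.symm.mul_dot (fun i j => (hSW j i).symm) i).symm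
  calc ∑ i, S i * dot S U * W i
      = dot S W * dot S U - Complex.I • dot S (cross S V) := by
        simp only [mul_assoc, hmove, mul_sub, mul_smul_comm, Finset.sum_sub_distrib,
          ← Finset.smul_sum]
        simp only [← mul_assoc, ← Finset.sum_mul, dot]
    _ = dot S W * dot S U + dot S V := by
        rw [hS.dot_cross_self, smul_smul, Complex.I_mul_I, neg_one_smul, sub_neg_eq_add]

theorem dot_quadField (hS : IsSpin s S) (hUW : IsVectorBracket U W V)
    (hSU : ∀ i j, Commute (S i) (U j)) (hSW : ∀ i j, Commute (S i) (W j))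
    (hSV : ∀ i j, Commute (S i) (V j)) (hs : s + 1 ≠ 0) :
    dot S (quadField s S U W V)
      = (2 * s * (s + 2)) • dot S V
        - (s * (s + 2) / (s + 1)) • (dot S U * dot S W + dot S W * dot S U)
        + (2 * s * (s + 1) * (s + 2)) • dot U W := by
  have hexpand : dot S (quadField s S U W V)
      = dot S S * dot S V + ∑ i, S i * dot S V * S i + (2 * (s + 1)) • dot S V
        - (1 / (s + 1)) • ((∑ i, S i * dot S U * S i) * dot S W
          + (∑ i, S i * dot S W * S i) * dot S U)
        + (2 * (s + 2)) • (dot S S * dot U W) - dot S U * dot S W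
        - ∑ i, S i * dot S U * W i := by
    have hdot (A : Fin 3 → R) : ∑ i, S i * A i = dot S A := rfl
    rw [← hdot]
    simp only [quadField, mul_add, mul_sub, mul_neg, mul_smul_comm, ← mul_assoc,
      Finset.sum_add_distrib, Finset.sum_sub_distrib, Finset.sum_neg_distrib, ← Finset.smul_sum,
      ← Finset.sum_mul, hdot S, hdot U, hdot V]
    module
  have hcoeff : s * (s + 2) / (s + 1) = 1 / (s + 1) * (s * (s + 1) - 1) + 1 := by
    field_simp
    ring
  rw [hexpand, hcoeff, hS.casimir, hS.sum_mul_dot_mul hSV, hS.sum_mul_dot_mul hSU,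
    hS.sum_mul_dot_mul hSW, hS.sum_mul_dot_mul_field hUW hSW]
  simp only [smul_mul_assoc, one_mul]
  module

end IsSpin

end VectorOperators

open MvPolynomial

/-! ### One spin in the Schwinger boson representation -/

section SingleSpin

variable {N : ℕ}

/-- The raising operator `S⁺ = a† b` of the site `α`. -/
def raise (α : Fin N) : Module.End ℂ (Fock N) :=
  create (α, true) * annihilate (α, false)

/-- The lowering operator `S⁻ = b† a` of the site `α`. -/
def lower (α : Fin N) : Module.End ℂ (Fock N) :=
  create (α, false) * annihilate (α, true)

/-- Twice the `z` component of the spin of the site `α`: `2 Sᶻ = a† a - b† b`. -/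
def weight (α : Fin N) : Module.End ℂ (Fock N) :=
  create (α, true) * annihilate (α, true) - create (α, false) * annihilate (α, false)

theorem raise_apply (α : Fin N) (p : Fock N) :
    raise α p = X (α, true) * pderiv (α, false) p := rfl

theorem lower_apply (α : Fin N) (p : Fock N) :
    lower α p = X (α, false) * pderiv (α, true) p := rfl

theorem weight_apply (α : Fin N) (p : Fock N) :
    weight α p = X (α, true) * pderiv (α, true) p - X (α, false) * pderiv (α, false) p := rfl

theorem fockSpin_zero (α : Fin N) : fockSpin α 0 = (1 / 2 : ℂ) • (raise α + lower α) := rfl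

theorem fockSpin_one (α : Fin N) : fockSpin α 1 = (-Complex.I / 2) • (raise α - lower α) := rfl

theorem fockSpin_two (α : Fin N) : fockSpin α 2 = (1 / 2 : ℂ) • weight α := rfl

theorem fockSpin_zero_apply (α : Fin N) (p : Fock N) :
    fockSpin α 0 p
      = C (1 / 2) * (X (α, true) * pderiv (α, false) p + X (α, false) * pderiv (α, true) p) :=
  smul_eq_C_mul _ _

theorem fockSpin_one_apply (α : Fin N) (p : Fock N) :
    fockSpin α 1 p
      = C (-Complex.I / 2)
        * (X (α, true) * pderiv (α, false) p - X (α, false) * pderiv (α, true) p) :=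
  smul_eq_C_mul _ _

theorem fockSpin_two_apply (α : Fin N) (p : Fock N) :
    fockSpin α 2 p
      = C (1 / 2) * (X (α, true) * pderiv (α, true) p - X (α, false) * pderiv (α, false) p) :=
  smul_eq_C_mul _ _

theorem pderiv_X_mul (α : Fin N) (c d : Bool) (p : Fock N) :
    pderiv (α, c) (X (α, d) * p) = (if c = d then p else 0) + X (α, d) * pderiv (α, c) p := by
  rw [pderiv_mul]
  split_ifs with h
  · rw [h, pderiv_X_self, one_mul]
  · rw [pderiv_X_of_ne (by simpa using Ne.symm h), zero_mul]

theorem raise_mul_lower (α : Fin N) : raise α * lower α = lower α * raise α + weight α := by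
  refine LinearMap.ext fun p => ?_
  simp only [Module.End.mul_apply, LinearMap.add_apply, raise_apply, lower_apply, weight_apply,
    pderiv_X_mul, if_true, pderiv_comm' (α, false) (α, true)]
  ring

theorem weight_mul_raise (α : Fin N) :
    weight α * raise α = raise α * weight α + (2 : ℂ) • raise α := by
  refine LinearMap.ext fun p => ?_
  simp only [Module.End.mul_apply, LinearMap.add_apply, raise_apply, weight_apply, map_sub,
    pderiv_X_mul, if_true, Bool.false_eq_true, if_false, pderiv_comm' (α, false) (α, true),
    two_smul]
  ring

theorem weight_mul_lower (α : Fin N) :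
    weight α * lower α = lower α * weight α - (2 : ℂ) • lower α := by
  refine LinearMap.ext fun p => ?_
  simp only [Module.End.mul_apply, LinearMap.sub_apply, LinearMap.add_apply, lower_apply,
    weight_apply, map_sub, pderiv_X_mul, if_true, Bool.true_eq_false, if_false,
    pderiv_comm' (α, false) (α, true), two_smul]
  ring

theorem casimir_raise_lower (α : Fin N) :
    (2 : ℂ) • (raise α * lower α + lower α * raise α) + weight α * weight α
      = bosonNumber α * bosonNumber α + (2 : ℂ) • bosonNumber α := by
  refine LinearMap.ext fun p => ?_
  simp only [Module.End.mul_apply, LinearMap.add_apply, raise_apply, lower_apply, weight_apply,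
    bosonNumber_apply, map_add, map_sub, pderiv_X_mul, if_true, Bool.true_eq_false,
    Bool.false_eq_true, if_false, pderiv_comm' (α, false) (α, true), two_smul]
  ring

theorem fockSpin_comm (α : Fin N) (i : Fin 3) :
    fockSpin α (i + 1) * fockSpin α (i + 2) - fockSpin α (i + 2) * fockSpin α (i + 1)
      = Complex.I • fockSpin α i := by
  have hraise := weight_mul_raise α
  have hlower := weight_mul_lower α
  have hweight := raise_mul_lower α
  fin_cases i
  · change fockSpin α 1 * fockSpin α 2 - fockSpin α 2 * fockSpin α 1 = Complex.I • fockSpin α 0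
    simp only [fockSpin_zero, fockSpin_one, fockSpin_two, smul_mul_assoc, mul_smul_comm, mul_sub,
      sub_mul, hraise, hlower]
    module
  · change fockSpin α 2 * fockSpin α 0 - fockSpin α 0 * fockSpin α 2 = Complex.I • fockSpin α 1
    simp only [fockSpin_zero, fockSpin_one, fockSpin_two, smul_mul_assoc, mul_smul_comm, mul_add,
      add_mul, hraise, hlower]
    linear_combination (norm := module) ((1 / 2) * Complex.I_mul_I) • (raise α - lower α)
  · change fockSpin α 0 * fockSpin α 1 - fockSpin α 1 * fockSpin α 0 = Complex.I • fockSpin α 2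
    simp only [fockSpin_zero, fockSpin_one, fockSpin_two, smul_mul_assoc, mul_smul_comm, mul_add,
      add_mul, mul_sub, sub_mul, hweight]
    module

theorem isVectorBracket_fockSpin (α : Fin N) :
    IsVectorBracket (fockSpin α) (fockSpin α) (fockSpin α) where
  commute_same _ := Commute.refl _
  bracket_pos := fockSpin_comm α
  bracket_neg i := by rw [← fockSpin_comm, neg_sub]

theorem dot_fockSpin (α : Fin N) :
    dot (fockSpin α) (fockSpin α)
      = (1 / 4 : ℂ) • (bosonNumber α * bosonNumber α + (2 : ℂ) • bosonNumber α) := by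
  rw [← casimir_raise_lower, dot, Fin.sum_univ_three, fockSpin_zero, fockSpin_one, fockSpin_two]
  simp only [smul_mul_assoc, mul_smul_comm, mul_add, add_mul, mul_sub, sub_mul]
  linear_combination (norm := module) ((1 / 4) * Complex.I_mul_I) •
    (raise α * raise α - raise α * lower α - lower α * raise α + lower α * lower α)

theorem commute_hop {α β : Fin N} (h : α ≠ β) (a b c d : Bool) :
    Commute (create (α, a) * annihilate (α, b)) (create (β, c) * annihilate (β, d)) := by
  refine LinearMap.ext fun p => ?_
  change X (α, a) * pderiv (α, b) (X (β, c) * pderiv (β, d) p)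
    = X (β, c) * pderiv (β, d) (X (α, a) * pderiv (α, b) p)
  simp only [pderiv_mul, pderiv_X, Pi.single_apply, pderiv_comm' (β, d) (α, b), Prod.mk.injEq,
    h, h.symm, false_and, if_false, zero_mul, zero_add]
  ring

theorem commute_fockSpin {α β : Fin N} (h : α ≠ β) (i j : Fin 3) :
    Commute (fockSpin α i) (fockSpin β j) := by
  have hc := commute_hop h
  fin_cases i <;> fin_cases j <;>
    simp only [fockSpin] <;>
    refine Commute.smul_left (Commute.smul_right ?_ _) _ <;>
    simp [Commute.add_left, Commute.add_right, Commute.sub_left, Commute.sub_right, hc]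

theorem fockSpin_mul (α : Fin N) (i : Fin 3) (p q : Fock N) :
    fockSpin α i (p * q) = fockSpin α i p * q + p * fockSpin α i q := by
  fin_cases i
  · change fockSpin α 0 _ = fockSpin α 0 _ * _ + _ * fockSpin α 0 _
    simp only [fockSpin_zero_apply, pderiv_mul]
    ring
  · change fockSpin α 1 _ = fockSpin α 1 _ * _ + _ * fockSpin α 1 _
    simp only [fockSpin_one_apply, pderiv_mul]
    ring
  · change fockSpin α 2 _ = fockSpin α 2 _ * _ + _ * fockSpin α 2 _
    simp only [fockSpin_two_apply, pderiv_mul]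
    ring

theorem fockSpin_pow (α : Fin N) (i : Fin 3) (p : Fock N) (n : ℕ) :
    fockSpin α i (p ^ n) = n • (p ^ (n - 1) * fockSpin α i p) :=
  (Derivation.mk' (fockSpin α i) fun p q => by
    rw [fockSpin_mul, smul_eq_mul, smul_eq_mul]; ring).leibniz_pow p n

/-! ### Spin one half: Fierz identities -/

section SpinHalf

variable {α : Fin N} {p q : Fock N}

theorem dot_fockSpin_apply {m : ℂ} (hp : bosonNumber α p = m • p) :
    ∑ i, fockSpin α i (fockSpin α i p) = (m / 2 * (m / 2 + 1)) • p := by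
  have h := LinearMap.congr_fun (dot_fockSpin α) p
  simp only [dot, LinearMap.sum_apply, Module.End.mul_apply, LinearMap.smul_apply,
    LinearMap.add_apply, hp, map_smul] at h
  rw [h]
  module

theorem sum_fockSpin_mul_fockSpin (hp : bosonNumber α p = p) (hq : bosonNumber α q = q) :
    ∑ i, fockSpin α i p * fockSpin α i q = (1 / 4 : ℂ) • (p * q) := by
  have hhalf : C (1 / 2) * C (1 / 2) = (C (1 / 4) : Fock N) := by
    rw [← C_mul]
    norm_num
  have hI : C (-Complex.I / 2) * C (-Complex.I / 2) = (-C (1 / 4) : Fock N) := by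
    rw [← C_mul, ← C_neg]
    congr 1
    linear_combination (1 / 4) * Complex.I_sq
  simp only [Fin.sum_univ_three, fockSpin_zero_apply, fockSpin_one_apply, fockSpin_two_apply,
    smul_eq_C_mul]
  rw [bosonNumber_apply] at hp hq
  generalize pderiv (α, true) p = u, pderiv (α, false) p = v, pderiv (α, true) q = u',
    pderiv (α, false) q = v' at *
  subst hp hq
  linear_combination ((X (α, true) * v - X (α, false) * u)
    * (X (α, true) * v' - X (α, false) * u')) * hI
    + ((X (α, true) * v + X (α, false) * u) * (X (α, true) * v' + X (α, false) * u')
    + (X (α, true) * u - X (α, false) * v) * (X (α, true) * u' - X (α, false) * v')) * hhalf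

theorem cross_fockSpin_mul_fockSpin (hp : bosonNumber α p = p) (hq : bosonNumber α q = q)
    (i : Fin 3) :
    Complex.I • (fockSpin α (i + 1) p * fockSpin α (i + 2) q
        - fockSpin α (i + 2) p * fockSpin α (i + 1) q)
      = (1 / 2 : ℂ) • (fockSpin α i p * q - p * fockSpin α i q) := by
  have hI : (C Complex.I : Fock N) ^ 2 = -1 := by rw [← C_pow, Complex.I_sq, C_neg, C_1]
  have hhalf : (C (-Complex.I / 2) : Fock N) = -(C Complex.I * C (1 / 2)) := by
    rw [← C_mul, ← C_neg]
    ring_nf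
  rw [bosonNumber_apply] at hp hq
  fin_cases i
  · change Complex.I • (fockSpin α 1 _ * fockSpin α 2 _ - fockSpin α 2 _ * fockSpin α 1 _)
      = (1 / 2 : ℂ) • (fockSpin α 0 _ * _ - _ * fockSpin α 0 _)
    simp only [fockSpin_zero_apply, fockSpin_one_apply, fockSpin_two_apply, smul_eq_C_mul, hhalf]
    generalize pderiv (α, true) p = u, pderiv (α, false) p = v, pderiv (α, true) q = u',
      pderiv (α, false) q = v' at *
    subst hp hq
    ring_nf
    rw [hI]
    ring
  · change Complex.I • (fockSpin α 2 _ * fockSpin α 0 _ - fockSpin α 0 _ * fockSpin α 2 _)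
      = (1 / 2 : ℂ) • (fockSpin α 1 _ * _ - _ * fockSpin α 1 _)
    simp only [fockSpin_zero_apply, fockSpin_one_apply, fockSpin_two_apply, smul_eq_C_mul, hhalf]
    generalize pderiv (α, true) p = u, pderiv (α, false) p = v, pderiv (α, true) q = u',
      pderiv (α, false) q = v' at *
    subst hp hq
    ring
  · change Complex.I • (fockSpin α 0 _ * fockSpin α 1 _ - fockSpin α 1 _ * fockSpin α 0 _)
      = (1 / 2 : ℂ) • (fockSpin α 2 _ * _ - _ * fockSpin α 2 _)
    simp only [fockSpin_zero_apply, fockSpin_one_apply, fockSpin_two_apply, smul_eq_C_mul, hhalf]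
    generalize pderiv (α, true) p = u, pderiv (α, false) p = v, pderiv (α, true) q = u',
      pderiv (α, false) q = v' at *
    subst hp hq
    ring_nf
    rw [hI]
    ring

theorem sum_fockSpin_pow_mul (hp : bosonNumber α p = p) (hq : bosonNumber α q = q) (n : ℕ) :
    ∑ j, fockSpin α j (p ^ n * fockSpin α j q) = (((n : ℂ) + 3) / 4) • (p ^ n * q) := by
  have hpow : n • (p ^ (n - 1) * p) = n • p ^ n := by
    cases n <;> simp [pow_succ]
  calc ∑ j, fockSpin α j (p ^ n * fockSpin α j q)
      = n • (p ^ (n - 1) * ∑ j, fockSpin α j p * fockSpin α j q)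
        + p ^ n * ∑ j, fockSpin α j (fockSpin α j q) := by
        simp only [fockSpin_mul, fockSpin_pow, Finset.sum_add_distrib, smul_mul_assoc, mul_assoc,
          Finset.mul_sum, Finset.smul_sum]
    _ = (1 / 4 : ℂ) • (n • (p ^ (n - 1) * p) * q) + (1 / 2 * (1 / 2 + 1) : ℂ) • (p ^ n * q) := by
        rw [sum_fockSpin_mul_fockSpin hp hq, dot_fockSpin_apply (hq.trans (one_smul ℂ q).symm)]
        simp only [mul_smul_comm, smul_mul_assoc, mul_assoc, smul_comm n]
    _ = (((n : ℂ) + 3) / 4) • (p ^ n * q) := by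
        rw [hpow, smul_mul_assoc, ← Nat.cast_smul_eq_nsmul ℂ]
        module

theorem cross_fockSpin_pow_mul (hp : bosonNumber α p = p) (hq : bosonNumber α q = q) (n : ℕ)
    (i : Fin 3) :
    Complex.I • (fockSpin α (i + 1) (p ^ n * fockSpin α (i + 2) q)
        - fockSpin α (i + 2) (p ^ n * fockSpin α (i + 1) q))
      = (1 / 2 : ℂ) • (fockSpin α i (p ^ n) * q)
        - ((n : ℂ) / 2 + 1) • (p ^ n * fockSpin α i q) := by
  have hpow : n • (p ^ (n - 1) * p) = n • p ^ n := by
    cases n <;> simp [pow_succ]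
  have hcomm := LinearMap.congr_fun (fockSpin_comm α i) q
  simp only [LinearMap.sub_apply, Module.End.mul_apply, LinearMap.smul_apply] at hcomm
  calc _ = n • (p ^ (n - 1) * (Complex.I • (fockSpin α (i + 1) p * fockSpin α (i + 2) q
            - fockSpin α (i + 2) p * fockSpin α (i + 1) q)))
          + p ^ n * (Complex.I • (fockSpin α (i + 1) (fockSpin α (i + 2) q)
            - fockSpin α (i + 2) (fockSpin α (i + 1) q))) := by
        simp only [fockSpin_mul, fockSpin_pow, nsmul_eq_mul, smul_eq_C_mul]
        ring
    _ = (1 / 2 : ℂ) • (n • (p ^ (n - 1) * fockSpin α i p) * q)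
          - (1 / 2 : ℂ) • (n • (p ^ (n - 1) * p) * fockSpin α i q) - p ^ n * fockSpin α i q := by
        rw [cross_fockSpin_mul_fockSpin hp hq, hcomm, smul_smul, Complex.I_mul_I]
        simp only [nsmul_eq_mul, smul_eq_C_mul, C_neg, C_1]
        ring
    _ = _ := by
        rw [hpow, fockSpin_pow, ← Nat.cast_smul_eq_nsmul ℂ, ← Nat.cast_smul_eq_nsmul ℂ]
        simp only [smul_mul_assoc]
        module

/-- `p ^ n` has spin `n / 2` at `α`, and coupling it to the spin `1 / 2` of `q` symmetrically leaves
no component of total spin `(n + 1) / 2 + 1`. -/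
theorem topProj_pow_mul_eq_zero (hp : bosonNumber α p = p) (hq : bosonNumber α q = q) {k n : ℕ}
    (hk : k = n + 1) (i : Fin 3) :
    Complex.I • (fockSpin α (i + 1) (p ^ n * fockSpin α (i + 2) q)
          - fockSpin α (i + 2) (p ^ n * fockSpin α (i + 1) q))
        + (qn k + 1) • (p ^ n * fockSpin α i q)
        - (1 / (qn k + 1)) • fockSpin α i (∑ j, fockSpin α j (p ^ n * fockSpin α j q)) = 0 := by
  have hn : (n : ℂ) + 3 ≠ 0 := by exact_mod_cast (n + 2).succ_ne_zero
  have hcoeff : (1 : ℂ) / (qn k + 1) * ((n + 3) / 4) = 1 / 2 := by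
    have : qn k + 1 = ((n : ℂ) + 3) / 2 := by
      rw [qn, hk]
      push_cast
      ring
    rw [this]
    field_simp
    norm_num
  rw [cross_fockSpin_pow_mul hp hq, sum_fockSpin_pow_mul hp hq, map_smul, smul_smul, hcoeff,
    fockSpin_mul, qn, hk]
  push_cast
  module

end SpinHalf

end SingleSpin

/-! ### Sites with at most one boson -/

section BosonNumber

variable {N : ℕ}

theorem coeff_bosonNumber (α : Fin N) (p : Fock N) (m : Fin N × Bool →₀ ℕ) :
    (bosonNumber α p).coeff m = (m (α, true) + m (α, false)) * p.coeff m := by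
  induction p using MvPolynomial.induction_on' with
  | monomial u a =>
    rw [bosonNumber_apply, X_mul_pderiv_monomial, X_mul_pderiv_monomial, ← add_smul,
      coeff_smul, coeff_monomial, nsmul_eq_mul]
    split_ifs with h
    · rw [h, Nat.cast_add]
    · rw [mul_zero, mul_zero]
  | add p q hp hq => rw [map_add, coeff_add, coeff_add, hp, hq, mul_add]

theorem eq_zero_of_bosonNumber_eq_neg {α : Fin N} {p : Fock N} (hp : bosonNumber α p = -p) :
    p = 0 := by
  ext m
  have hm : ((m (α, true) + m (α, false) + 1 : ℕ) : ℂ) * p.coeff m = 0 := by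
    have h := coeff_bosonNumber α p m
    rw [hp, coeff_neg] at h
    push_cast
    linear_combination -h
  simpa only [coeff_zero] using (mul_eq_zero.mp hm).resolve_left (Nat.cast_ne_zero.mpr (by omega))

theorem bosonNumber_pderiv (α : Fin N) (c : Bool) (p : Fock N) :
    bosonNumber α (pderiv (α, c) p) = pderiv (α, c) (bosonNumber α p) - pderiv (α, c) p := by
  rw [bosonNumber_apply, bosonNumber_apply, map_add, pderiv_X_mul, pderiv_X_mul,
    pderiv_comm' _ (α, c), pderiv_comm' _ (α, c)]
  cases c <;> simp only [Bool.false_eq_true, Bool.true_eq_false, if_true, if_false] <;> ring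

theorem pderiv_eq_zero_of_bosonNumber {α : Fin N} {p : Fock N} (hp : bosonNumber α p = 0)
    (c : Bool) : pderiv (α, c) p = 0 :=
  eq_zero_of_bosonNumber_eq_neg (by rw [bosonNumber_pderiv, hp, map_zero, zero_sub])

theorem pderiv_pderiv_eq_zero_of_bosonNumber {α : Fin N} {p : Fock N} (hp : bosonNumber α p = p)
    (c d : Bool) : pderiv (α, c) (pderiv (α, d) p) = 0 :=
  pderiv_eq_zero_of_bosonNumber (by rw [bosonNumber_pderiv, hp, sub_self]) c

theorem raise_raise_eq_zero {α : Fin N} {p : Fock N} (hp : bosonNumber α p = p) :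
    raise α (raise α p) = 0 := by
  rw [raise_apply, raise_apply, pderiv_X_mul, pderiv_pderiv_eq_zero_of_bosonNumber hp]
  simp

theorem bosonNumber_hsPoly (α : Fin N) : bosonNumber α (hsPoly N) = hsPoly N := by
  simpa only [Nat.cast_one, one_smul] using mem_spinSpace.mp hsPoly_mem α

end BosonNumber

/-! ### Sums over the sites of the ring -/

section Eta

variable {N : ℕ}

theorem eta_eq_pow (α : Fin N) :
    eta α = Complex.exp (2 * Real.pi * Complex.I / N) ^ ((α : ℕ) + 1) := by
  rw [eta, ← Complex.exp_nat_mul]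
  congr 1
  push_cast
  ring

theorem eta_pow_card (α : Fin N) : eta α ^ N = 1 := by
  rw [eta_eq_pow, pow_right_comm, (Complex.isPrimitiveRoot_exp N α.pos.ne').pow_eq_one, one_pow]

theorem eta_ne_zero (α : Fin N) : eta α ≠ 0 := Complex.exp_ne_zero _

theorem eta_injective : Function.Injective (eta (N := N)) := by
  intro α β h
  have hroot := Complex.isPrimitiveRoot_exp N α.pos.ne'
  rw [eta_eq_pow, eta_eq_pow, pow_succ, pow_succ] at h
  exact Fin.ext (hroot.pow_inj α.2 β.2 (mul_right_cancel₀ (Complex.exp_ne_zero _) h))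

theorem eta_sub_ne_zero {α β : Fin N} (h : α ≠ β) : eta α - eta β ≠ 0 :=
  sub_ne_zero.mpr (eta_injective.ne h)

theorem norm_eta (α : Fin N) : ‖eta α‖ = 1 :=
  Complex.norm_eq_one_of_pow_eq_one (eta_pow_card α) α.pos.ne'

theorem conj_eta (α : Fin N) : starRingEnd ℂ (eta α) = (eta α)⁻¹ :=
  (Complex.inv_eq_conj (norm_eta α)).symm

theorem sum_eta_pow {m : ℕ} (hm : 0 < m) (hmN : m < N) : ∑ α : Fin N, eta α ^ m = 0 := by
  have hroot := Complex.isPrimitiveRoot_exp N (hm.trans hmN).ne'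
  set ζ := Complex.exp (2 * Real.pi * Complex.I / N)
  have hgeom : ∑ a ∈ Finset.range N, (ζ ^ m) ^ a = 0 := by
    rw [geom_sum_eq (hroot.pow_ne_one_of_pos_of_lt hm.ne' hmN), pow_right_comm, hroot.pow_eq_one,
      one_pow, sub_self, zero_div]
  calc ∑ α : Fin N, eta α ^ m = ∑ α : Fin N, ζ ^ m * (ζ ^ m) ^ (α : ℕ) :=
        Finset.sum_congr rfl fun α _ => by rw [eta_eq_pow]; ring
    _ = 0 := by
        rw [← Finset.mul_sum, Fin.sum_univ_eq_sum_range fun a => (ζ ^ m) ^ a, hgeom, mul_zero]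

theorem sum_eval_eta {p : Polynomial ℂ} (hp : p.natDegree < N) (h0 : p.coeff 0 = 0) :
    ∑ α : Fin N, p.eval (eta α) = 0 := by
  simp_rw [Polynomial.eval_eq_sum_range]
  rw [Finset.sum_comm]
  refine Finset.sum_eq_zero fun m hm => ?_
  rw [← Finset.mul_sum]
  rcases Nat.eq_zero_or_pos m with rfl | hpos
  · rw [h0, zero_mul]
  · rw [sum_eta_pow hpos ((Finset.mem_range_succ_iff.mp hm).trans_lt hp), mul_zero]

theorem natDegree_prod_sq_le (B : Finset (Fin N)) :
    (∏ β ∈ B, (Polynomial.X - Polynomial.C (eta β)) ^ 2).natDegree ≤ 2 * B.card := by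
  refine (Polynomial.natDegree_prod_le _ _).trans ?_
  rw [mul_comm]
  refine Finset.sum_le_card_nsmul _ _ _ fun β _ => ?_
  exact Polynomial.natDegree_pow_le.trans (by rw [Polynomial.natDegree_X_sub_C])

theorem sum_eta_mul_prod_sq {B : Finset (Fin N)} (hB : 2 * B.card + 1 < N) :
    ∑ β : Fin N, eta β * ∏ j ∈ B, (eta β - eta j) ^ 2 = 0 := by
  have hdegree : (Polynomial.X * ∏ j ∈ B, (Polynomial.X - Polynomial.C (eta j)) ^ 2).natDegree
      ≤ 1 + 2 * B.card :=
    Polynomial.natDegree_mul_le_of_le Polynomial.natDegree_X_le (natDegree_prod_sq_le B)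
  simpa [Polynomial.eval_prod] using
    sum_eval_eta (N := N) (hdegree.trans_lt (by omega)) (by simp)

theorem sum_div_eta_mul_prod_sq {B : Finset (Fin N)} {α : Fin N} (hα : α ∈ B)
    (hB : 2 * B.card < N) :
    ∑ β ∈ Finset.univ.erase α,
      1 / (eta α - eta β) * (eta β * ∏ j ∈ B, (eta β - eta j) ^ 2) = 0 := by
  have hdegree : (Polynomial.X * ((Polynomial.X - Polynomial.C (eta α)) *
      ∏ j ∈ B.erase α, (Polynomial.X - Polynomial.C (eta j)) ^ 2)).natDegree
      ≤ 1 + (1 + 2 * (B.erase α).card) :=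
    Polynomial.natDegree_mul_le_of_le Polynomial.natDegree_X_le
      (Polynomial.natDegree_mul_le_of_le (Polynomial.natDegree_X_sub_C_le _)
        (natDegree_prod_sq_le _))
  have hcard := Finset.card_erase_add_one hα
  have h := sum_eval_eta (N := N) (hdegree.trans_lt (by omega)) (by simp)
  rw [← Finset.add_sum_erase _ _ (Finset.mem_univ α)] at h
  simp only [Polynomial.eval_mul, Polynomial.eval_sub, Polynomial.eval_X, Polynomial.eval_C,
    Polynomial.eval_prod, Polynomial.eval_pow, sub_self, zero_mul, mul_zero, zero_add] at h
  rw [← neg_eq_zero, ← h, ← Finset.sum_neg_distrib]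
  refine Finset.sum_congr rfl fun β hβ => ?_
  have hne := eta_sub_ne_zero (Finset.ne_of_mem_erase hβ).symm
  rw [← Finset.mul_prod_erase B _ hα]
  field_simp
  ring

end Eta

/-! ### The Haldane–Shastry state -/

section HaldaneShastry

variable {N : ℕ}

/-- The configuration with up spins on `A`. -/
def config (A : Finset (Fin N)) : Fock N := (∏ α ∈ A, X (α, true)) * ∏ α ∈ Aᶜ, X (α, false)

theorem hsPoly_eq_sum_config :
    hsPoly N = ∑ A ∈ (Finset.univ : Finset (Fin N)).powersetCard (N / 2), hsWave A • config A := rfl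

theorem exists_config_eq_X_mul {A : Finset (Fin N)} {α : Fin N} (h : α ∈ A) :
    ∃ u, (∀ c, pderiv (α, c) u = 0) ∧ config A = X (α, true) * u
      ∧ config (A.erase α) = X (α, false) * u := by
  refine ⟨(∏ β ∈ A.erase α, X (β, true)) * ∏ β ∈ Aᶜ, X (β, false),
    pderiv_eq_zero_of_bosonNumber ?_, ?_, ?_⟩
  · rw [bosonNumber_mul, bosonNumber_prod, bosonNumber_prod]
    simp [h]
  · rw [config, ← Finset.mul_prod_erase A _ h, mul_assoc]
  · rw [config, Finset.compl_erase, Finset.prod_insert (by simpa using h)]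
    ring

theorem pderiv_true_config {A : Finset (Fin N)} {α : Fin N} (h : α ∉ A) :
    pderiv (α, true) (config A) = 0 := by
  obtain ⟨u, hu, -, herase⟩ := exists_config_eq_X_mul (Finset.mem_insert_self α A)
  rw [Finset.erase_insert h] at herase
  simp [herase, hu]

theorem pderiv_false_config {A : Finset (Fin N)} {α : Fin N} (h : α ∈ A) :
    pderiv (α, false) (config A) = 0 := by
  obtain ⟨u, hu, hA, -⟩ := exists_config_eq_X_mul h
  simp [hA, hu]

theorem bosonNumber_config (A : Finset (Fin N)) (α : Fin N) :
    bosonNumber α (config A) = config A := by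
  rw [config, bosonNumber_mul, bosonNumber_prod, bosonNumber_prod]
  by_cases h : α ∈ A <;> simp [h]

theorem lower_config (A : Finset (Fin N)) (α : Fin N) :
    lower α (config A) = if α ∈ A then config (A.erase α) else 0 := by
  split_ifs with h
  · obtain ⟨u, hu, hA, herase⟩ := exists_config_eq_X_mul h
    simp [hA, herase, lower_apply, hu]
  · rw [lower_apply, pderiv_true_config h, mul_zero]

theorem weight_config (A : Finset (Fin N)) (α : Fin N) :
    weight α (config A) = if α ∈ A then config A else -config A := by
  have hboson := bosonNumber_config A α
  rw [bosonNumber_apply] at hboson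
  rw [weight_apply]
  split_ifs with h
  · rw [pderiv_false_config h, mul_zero] at hboson ⊢
    rwa [sub_zero, ← add_zero (X _ * _)]
  · rw [pderiv_true_config h, mul_zero, zero_add] at hboson
    rw [pderiv_true_config h, mul_zero, hboson, zero_sub]

theorem hsWave_insert {B : Finset (Fin N)} {β : Fin N} (h : β ∉ B) :
    hsWave (insert β B) = hsWave B * (eta β * ∏ j ∈ B, (eta β - eta j) ^ 2) := by
  have hpairs : ∏ i ∈ insert β B, ∏ j ∈ insert β B with i < j, (eta i - eta j) ^ 2
      = (∏ j ∈ B, (eta β - eta j) ^ 2) * ∏ i ∈ B, ∏ j ∈ B with i < j, (eta i - eta j) ^ 2 := by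
    simp_rw [Finset.prod_filter]
    rw [Finset.prod_insert h]
    simp_rw [Finset.prod_insert h]
    rw [Finset.prod_mul_distrib, if_neg (lt_irrefl β), one_mul, ← mul_assoc,
      ← Finset.prod_mul_distrib]
    congr 1
    refine Finset.prod_congr rfl fun j hj => ?_
    rcases lt_or_gt_of_ne (ne_of_mem_of_not_mem hj h) with hlt | hlt
    · rw [if_pos hlt, if_neg hlt.asymm, one_mul, ← neg_sub, neg_sq]
    · rw [if_pos hlt, if_neg hlt.asymm, mul_one]
  rw [hsWave, hsWave, hpairs, Finset.prod_insert h]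
  ring

theorem lower_hsPoly (hN : 2 ≤ N) (β : Fin N) :
    lower β (hsPoly N) = ∑ B ∈ (Finset.univ : Finset (Fin N)).powersetCard (N / 2 - 1),
      (hsWave B * (eta β * ∏ j ∈ B, (eta β - eta j) ^ 2)) • config B := by
  have hpos : 0 < N / 2 := by omega
  have hvanish : ∀ B : Finset (Fin N), β ∈ B → ∏ j ∈ B, (eta β - eta j) ^ 2 = 0 := fun B hB =>
    Finset.prod_eq_zero hB (by simp)
  rw [hsPoly_eq_sum_config, map_sum]
  simp_rw [map_smul, lower_config, smul_ite, smul_zero]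
  rw [← Finset.sum_filter]
  refine Eq.trans ?_ (Finset.sum_filter_of_ne (p := fun B => β ∉ B)
    (fun B _ hB hmem => hB (by rw [hvanish B hmem]; simp)))
  refine Finset.sum_bij' (fun A _ => A.erase β) (fun B _ => insert β B) ?_ ?_ ?_ ?_ ?_
  · intro A hA
    simp only [Finset.mem_filter, Finset.mem_powersetCard_univ] at hA ⊢
    exact ⟨by rw [Finset.card_erase_of_mem hA.2, hA.1], Finset.notMem_erase β A⟩
  · intro B hB
    simp only [Finset.mem_filter, Finset.mem_powersetCard_univ] at hB ⊢
    exact ⟨by rw [Finset.card_insert_of_notMem hB.2, hB.1]; omega, Finset.mem_insert_self β B⟩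
  · intro A hA
    exact Finset.insert_erase (Finset.mem_filter.mp hA).2
  · intro B hB
    exact Finset.erase_insert (Finset.mem_filter.mp hB).2
  · intro A hA
    rw [← hsWave_insert (Finset.notMem_erase β A),
      Finset.insert_erase (Finset.mem_filter.mp hA).2]

theorem sum_lower_hsPoly (hN : 2 ≤ N) : ∑ β : Fin N, lower β (hsPoly N) = 0 := by
  simp_rw [lower_hsPoly hN]
  rw [Finset.sum_comm]
  refine Finset.sum_eq_zero fun B hB => ?_
  rw [Finset.mem_powersetCard_univ] at hB
  rw [← Finset.sum_smul, ← Finset.mul_sum, sum_eta_mul_prod_sq (by omega), mul_zero, zero_smul]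

theorem pderiv_sum_lower_hsPoly (hN : 2 ≤ N) (α : Fin N) :
    pderiv (α, true) (∑ β ∈ Finset.univ.erase α,
      (1 / (eta α - eta β)) • lower β (hsPoly N)) = 0 := by
  simp_rw [lower_hsPoly hN, Finset.smul_sum, smul_smul]
  rw [Finset.sum_comm, map_sum]
  refine Finset.sum_eq_zero fun B hB => ?_
  rw [Finset.mem_powersetCard_univ] at hB
  rw [← Finset.sum_smul]
  by_cases hα : α ∈ B
  · simp_rw [mul_left_comm _ (hsWave B)]
    rw [← Finset.mul_sum, sum_div_eta_mul_prod_sq hα (by omega), mul_zero, zero_smul, map_zero]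
  · rw [Derivation.map_smul, pderiv_true_config hα, smul_zero]

theorem sum_weight_hsPoly (hN : Even N) : ∑ β : Fin N, weight β (hsPoly N) = 0 := by
  have hconfig : ∀ A ∈ (Finset.univ : Finset (Fin N)).powersetCard (N / 2),
      ∑ β : Fin N, weight β (config A) = 0 := by
    intro A hA
    rw [Finset.mem_powersetCard_univ] at hA
    obtain ⟨m, rfl⟩ := hN
    have hup : ∑ β ∈ A, weight β (config A) = A.card • config A :=
      Finset.sum_eq_card_nsmul fun β hβ => by rw [weight_config, if_pos hβ]
    have hdown : ∑ β ∈ Aᶜ, weight β (config A) = Aᶜ.card • -config A :=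
      Finset.sum_eq_card_nsmul fun β hβ => by
        rw [weight_config, if_neg (Finset.mem_compl.mp hβ)]
    have hcard : Aᶜ.card = A.card := by rw [Finset.card_compl, Fintype.card_fin, hA]; omega
    rw [← Finset.sum_add_sum_compl A, hup, hdown, hcard, smul_neg, add_neg_cancel]
  simp_rw [hsPoly_eq_sum_config, map_sum, map_smul]
  rw [Finset.sum_comm]
  refine Finset.sum_eq_zero fun A hA => ?_
  rw [← Finset.smul_sum, hconfig A hA, smul_zero]

end HaldaneShastry

/-! ### Singlets -/

section Singlet

attribute [local instance] LieRing.ofAssociativeRing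

theorem sl2_f_apply_eq_zero {K V : Type*} [Field K] [CharZero K] [AddCommGroup V] [Module K V]
    {h e f : Module.End K V} (t : IsSl2Triple h e f) {p : V} (hh : h p = 0) (he : e p = 0)
    {n : ℕ} (hn : (f ^ n) p = 0) : f p = 0 := by
  rcases eq_or_ne p 0 with rfl | hp
  · exact map_zero f
  have hprim : t.HasPrimitiveVectorWith p (0 : K) := ⟨hp, by rw [zero_smul]; exact hh, he⟩
  have hdescend (m : ℕ) (hm : (f ^ (m + 2)) p = 0) : (f ^ (m + 1)) p = 0 := by
    have h := hprim.lie_e_pow_succ_toEnd_f (m + 1)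
    rw [LieModule.toEnd_module_end, LieHom.id_apply, hm, lie_zero] at h
    refine (smul_eq_zero.mp h.symm).resolve_left (mul_ne_zero ?_ ?_)
    · exact_mod_cast (m + 1).succ_ne_zero
    · rw [zero_sub, neg_ne_zero]
      exact_mod_cast m.succ_ne_zero
  rcases n with - | n
  · exact absurd hn hp
  · induction n with
    | zero => simpa using hn
    | succ m ih => exact ih (hdescend m hn)

variable {N : ℕ}

/-- Raising operator of the total spin. -/
def raiseTot : Module.End ℂ (Fock N) := ∑ α, raise α

theorem raiseTot_apply (p : Fock N) : raiseTot p = ∑ α, raise α p := LinearMap.sum_apply _ _ _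

theorem commute_raise_raise (α β : Fin N) : Commute (raise α) (raise β) := by
  rcases eq_or_ne α β with rfl | h
  · exact Commute.refl _
  · exact commute_hop h _ _ _ _

theorem commute_raiseTot_raise (β : Fin N) : Commute raiseTot (raise β) :=
  Commute.sum_left _ _ _ fun α _ => commute_raise_raise α β

theorem lie_raise_lower_self (α : Fin N) : ⁅raise α, lower α⁆ = weight α := by
  rw [Ring.lie_def, raise_mul_lower, add_sub_cancel_left]

theorem lie_raise_weight_self (α : Fin N) : ⁅raise α, weight α⁆ = -((2 : ℂ) • raise α) := by
  rw [Ring.lie_def, weight_mul_raise, sub_add_cancel_left]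

theorem lie_sum_of_commute {R : Type*} [Ring R] {A : Fin N → R} {β : Fin N} {B : R}
    (h : ∀ α, α ≠ β → Commute (A α) B) : ⁅∑ α, A α, B⁆ = ⁅A β, B⁆ := by
  rw [sum_lie]
  exact Fintype.sum_eq_single β fun α hα => (h α hα).lie_eq

theorem lie_raiseTot_lower (β : Fin N) : ⁅raiseTot (N := N), lower β⁆ = weight β :=
  (lie_sum_of_commute (A := raise) fun _ h => commute_hop h _ _ _ _).trans
    (lie_raise_lower_self β)

theorem lie_raiseTot_weight (β : Fin N) : ⁅raiseTot (N := N), weight β⁆ = -((2 : ℂ) • raise β) :=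
  (lie_sum_of_commute (A := raise) (B := weight β) fun _ h =>
    (commute_hop h _ _ _ _).sub_right (commute_hop h _ _ _ _)).trans (lie_raise_weight_self β)

theorem lie_lowerTot_weight (β : Fin N) :
    ⁅∑ α : Fin N, lower α, weight β⁆ = (2 : ℂ) • lower β := by
  rw [lie_sum_of_commute (A := lower) (B := weight β) fun _ h =>
    (commute_hop h _ _ _ _).sub_right (commute_hop h _ _ _ _), Ring.lie_def, weight_mul_lower,
    sub_sub_cancel]

theorem weight_sum_ne_zero (α : Fin N) : -∑ β : Fin N, weight β ≠ 0 := by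
  intro h
  have h := LinearMap.congr_fun h (X (α, true))
  simp [weight_apply, pderiv_X, Pi.single_apply, Finset.sum_ite_eq] at h

theorem isSl2Triple_raiseTot (α : Fin N) :
    IsSl2Triple (-∑ β : Fin N, weight β) (∑ β, lower β) raiseTot where
  h_ne_zero := weight_sum_ne_zero α
  lie_e_f := by
    rw [← lie_skew, lie_sum]
    simp_rw [lie_raiseTot_lower]
  lie_h_e_nsmul := by
    rw [neg_lie, lie_skew, lie_sum]
    simp_rw [lie_lowerTot_weight]
    rw [← Finset.smul_sum, ofNat_smul_eq_nsmul]
  lie_h_f_nsmul := by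
    rw [neg_lie, lie_skew, lie_sum]
    simp_rw [lie_raiseTot_weight]
    rw [Finset.sum_neg_distrib, ← Finset.smul_sum, ofNat_smul_eq_nsmul, raiseTot]

theorem raise_mem {k : ℕ} (α : Fin N) : ∀ p ∈ SpinSpace N k, raise α p ∈ SpinSpace N k := by
  intro p hp
  rw [mem_spinSpace] at hp ⊢
  intro β
  rw [← Module.End.mul_apply, raise, (bosonNumber_hop β α _ _).eq, Module.End.mul_apply, hp,
    map_smul]

theorem exists_raiseTot_pow_eq_zero {p : Fock N} (hp : p ∈ SpinSpace N 1) :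
    ∃ n, (raiseTot ^ n) p = 0 := by
  let raiseOn (α : Fin N) : Module.End ℂ (SpinSpace N 1) := (raise α).restrict (raise_mem α)
  have hsq (α : Fin N) : IsNilpotent (raiseOn α) := by
    refine ⟨2, LinearMap.ext fun q => Subtype.ext ?_⟩
    have hq := mem_spinSpace.mp q.2 α
    rw [Nat.cast_one, one_smul] at hq
    simpa [sq, raiseOn] using raise_raise_eq_zero hq
  have hcomm (α β : Fin N) : Commute (raiseOn α) (raiseOn β) :=
    LinearMap.ext fun q => Subtype.ext
      (LinearMap.congr_fun (commute_raise_raise α β).eq (q : Fock N))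
  have hcoe (q : SpinSpace N 1) : ((∑ α, raiseOn α) q : Fock N) = raiseTot q := by
    simp [raiseTot_apply, raiseOn]
  have hmem (q : Fock N) (hq : q ∈ SpinSpace N 1) : raiseTot q ∈ SpinSpace N 1 :=
    hcoe ⟨q, hq⟩ ▸ Subtype.property _
  have hrestrict : ∑ α, raiseOn α = raiseTot.restrict hmem :=
    LinearMap.ext fun q => Subtype.ext (hcoe q)
  obtain ⟨n, hn⟩ := Commute.isNilpotent_sum (s := Finset.univ) (fun α _ => hsq α)
    fun α β _ _ => hcomm α β
  rw [hrestrict, Module.End.pow_restrict] at hn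
  exact ⟨n, congrArg Subtype.val (LinearMap.congr_fun hn ⟨p, hp⟩)⟩

theorem raiseTot_hsPoly (hN : Even N) (hN2 : 2 ≤ N) : raiseTot (hsPoly N) = 0 := by
  obtain ⟨n, hn⟩ := exists_raiseTot_pow_eq_zero (N := N) hsPoly_mem
  refine sl2_f_apply_eq_zero (isSl2Triple_raiseTot ⟨0, by lia⟩) ?_ ?_ hn
  · rw [LinearMap.neg_apply, LinearMap.sum_apply, sum_weight_hsPoly hN, neg_zero]
  · rw [LinearMap.sum_apply, sum_lower_hsPoly hN2]

theorem sum_fockSpin_hsPoly (hN : Even N) (hN2 : 2 ≤ N) (i : Fin 3) :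
    ∑ β, fockSpin β i (hsPoly N) = 0 := by
  have hlower := sum_lower_hsPoly hN2
  have hweight := sum_weight_hsPoly hN
  have hraise := raiseTot_hsPoly hN hN2
  rw [raiseTot_apply] at hraise
  fin_cases i
  · change ∑ β, fockSpin β 0 (hsPoly N) = 0
    simp [fockSpin_zero, ← Finset.smul_sum, Finset.sum_add_distrib, hlower, hraise]
  · change ∑ β, fockSpin β 1 (hsPoly N) = 0
    simp [fockSpin_one, ← Finset.smul_sum, Finset.sum_sub_distrib, hlower, hraise]
  · change ∑ β, fockSpin β 2 (hsPoly N) = 0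
    simp [fockSpin_two, ← Finset.smul_sum, hweight]

end Singlet

/-! ### Transfer of a field to a single site -/

section Transfer

attribute [local instance] LieRing.ofAssociativeRing

variable {N : ℕ}

theorem weight_of_pderiv_eq_zero {α : Fin N} {L : Fock N} (hL : bosonNumber α L = L)
    (hdown : pderiv (α, true) L = 0) : weight α L = -L := by
  rw [bosonNumber_apply, hdown, mul_zero, zero_add] at hL
  rw [weight_apply, hdown, mul_zero, zero_sub, hL]

theorem lower_raise_of_pderiv_eq_zero {α : Fin N} {L : Fock N} (hL : bosonNumber α L = L)
    (hdown : pderiv (α, true) L = 0) : lower α (raise α L) = L := by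
  have h := LinearMap.congr_fun (raise_mul_lower α) L
  rw [LinearMap.add_apply, Module.End.mul_apply, Module.End.mul_apply, lower_apply, hdown,
    mul_zero, map_zero, weight_of_pderiv_eq_zero hL hdown, ← sub_eq_add_neg] at h
  exact sub_eq_zero.mp h.symm

theorem weight_raise_of_pderiv_eq_zero {α : Fin N} {L : Fock N} (hL : bosonNumber α L = L)
    (hdown : pderiv (α, true) L = 0) : weight α (raise α L) = raise α L := by
  have h := LinearMap.congr_fun (weight_mul_raise α) L
  rw [LinearMap.add_apply, Module.End.mul_apply, Module.End.mul_apply,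
    weight_of_pderiv_eq_zero hL hdown, map_neg, LinearMap.smul_apply] at h
  rw [h]
  module

theorem exists_ladder {α : Fin N} {L : Fock N} (hL : bosonNumber α L = L)
    (hdown : pderiv (α, true) L = 0) (hL3 : raiseTot (raiseTot (raiseTot L)) = 0) :
    ∃ g, bosonNumber α g = g ∧ lower α g = L ∧ weight α g = raiseTot L
      ∧ raise α g = -(1 / 2 : ℂ) • raiseTot (raiseTot L) := by
  set ρ : Module.End ℂ (Fock N) := raiseTot - raise α with hρ
  have hρ_raise (p : Fock N) : ρ (raise α p) = raise α (ρ p) :=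
    LinearMap.congr_fun ((commute_raiseTot_raise α).sub_left (Commute.refl _)).eq p
  have hρ_lower (p : Fock N) : ρ (lower α p) = lower α (ρ p) := by
    have h : ⁅ρ, lower α⁆ = 0 := by
      rw [hρ, sub_lie, lie_raiseTot_lower, lie_raise_lower_self, sub_self]
    exact LinearMap.congr_fun (commute_iff_lie_eq.mpr h).eq p
  have hρ_weight (p : Fock N) : ρ (weight α p) = weight α (ρ p) := by
    have h : ⁅ρ, weight α⁆ = 0 := by
      rw [hρ, sub_lie, lie_raiseTot_weight, lie_raise_weight_self, sub_self]
    exact LinearMap.congr_fun (commute_iff_lie_eq.mpr h).eq p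
  have htot (p : Fock N) : raiseTot p = raise α p + ρ p := by
    rw [hρ, LinearMap.sub_apply, add_sub_cancel]
  have hlower : lower α L = 0 := by rw [lower_apply, hdown, mul_zero]
  have hweight := weight_of_pderiv_eq_zero hL hdown
  have hraise := raise_raise_eq_zero hL
  have hlower_raise := lower_raise_of_pderiv_eq_zero hL hdown
  have hweight_raise := weight_raise_of_pderiv_eq_zero hL hdown
  have htot2 : raiseTot (raiseTot L) = (2 : ℂ) • raise α (ρ L) + ρ (ρ L) := by
    simp only [htot, map_add, hraise, hρ_raise, zero_add]
    module
  have hρ2 : ρ (ρ L) = 0 := by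
    have h3 : (3 : ℂ) • raise α (ρ (ρ L)) + ρ (ρ (ρ L)) = 0 := by
      rw [← hL3, htot2]
      simp only [htot, map_add, map_smul, ← hρ_raise, hraise, map_zero]
      module
    have h := congrArg (lower α) h3
    simp only [map_add, map_smul, ← hρ_raise, ← hρ_lower, hlower_raise, hlower, map_zero,
      add_zero] at h
    exact (smul_eq_zero.mp h).resolve_left three_ne_zero
  refine ⟨raise α L - ρ L, ?_, ?_, ?_, ?_⟩
  · have hcommute : Commute (bosonNumber α) (raise α - ρ) :=
      (bosonNumber_hop α α _ _).sub_right ((Commute.sum_right _ _ _ fun β _ =>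
        bosonNumber_hop α β _ _).sub_right (bosonNumber_hop α α _ _))
    have h := LinearMap.congr_fun hcommute.eq L
    rwa [Module.End.mul_apply, Module.End.mul_apply, hL] at h
  · rw [map_sub, hlower_raise, ← hρ_lower, hlower, map_zero, sub_zero]
  · rw [map_sub, hweight_raise, ← hρ_weight, hweight, map_neg, sub_neg_eq_add, ← htot]
  · rw [map_sub, hraise, htot2, hρ2]
    module

theorem raiseTot_lower {p : Fock N} (hraise : raiseTot p = 0) (β : Fin N) :
    raiseTot (lower β p) = weight β p := by
  rw [← lie_raiseTot_lower, Ring.lie_def, LinearMap.sub_apply, Module.End.mul_apply,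
    Module.End.mul_apply, hraise, map_zero, sub_zero]

theorem raiseTot_weight {p : Fock N} (hraise : raiseTot p = 0) (β : Fin N) :
    raiseTot (weight β p) = (-2 : ℂ) • raise β p := by
  have h := LinearMap.congr_fun (lie_raiseTot_weight β) p
  rwa [Ring.lie_def, LinearMap.sub_apply, Module.End.mul_apply, Module.End.mul_apply, hraise,
    map_zero, sub_zero, LinearMap.neg_apply, LinearMap.smul_apply, ← neg_smul] at h

theorem raiseTot_raise {p : Fock N} (hraise : raiseTot p = 0) (β : Fin N) :
    raiseTot (raise β p) = 0 := by
  rw [← Module.End.mul_apply, (commute_raiseTot_raise β).eq, Module.End.mul_apply, hraise,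
    map_zero]

theorem exists_fockSpin_eq_sum {α : Fin N} {p : Fock N} (hp : bosonNumber α p = p)
    (hraise : raiseTot p = 0) (c : Fin N → ℂ)
    (hdown : pderiv (α, true) (∑ β ∈ Finset.univ.erase α, c β • lower β p) = 0) :
    ∃ g, bosonNumber α g = g ∧
      ∀ i, ∑ β ∈ Finset.univ.erase α, c β • fockSpin β i p = fockSpin α i g := by
  have hL : bosonNumber α (∑ β ∈ Finset.univ.erase α, c β • lower β p)
      = ∑ β ∈ Finset.univ.erase α, c β • lower β p := by
    simp_rw [map_sum, map_smul, ← Module.End.mul_apply]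
    refine Finset.sum_congr rfl fun β _ => ?_
    rw [lower, (bosonNumber_hop α β _ _).eq, Module.End.mul_apply, hp]
  have hL1 : raiseTot (∑ β ∈ Finset.univ.erase α, c β • lower β p)
      = ∑ β ∈ Finset.univ.erase α, c β • weight β p := by
    simp_rw [map_sum, map_smul, raiseTot_lower hraise]
  have hL2 : raiseTot (∑ β ∈ Finset.univ.erase α, c β • weight β p)
      = (-2 : ℂ) • ∑ β ∈ Finset.univ.erase α, c β • raise β p := by
    simp_rw [map_sum, map_smul, raiseTot_weight hraise, Finset.smul_sum, smul_comm (-2 : ℂ)]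
  have hL3 : raiseTot (∑ β ∈ Finset.univ.erase α, c β • raise β p) = 0 := by
    simp_rw [map_sum, map_smul, raiseTot_raise hraise, smul_zero, Finset.sum_const_zero]
  obtain ⟨g, hg, hlower, hweight, hraise'⟩ :=
    exists_ladder hL hdown (by rw [hL1, hL2, map_smul, hL3, smul_zero])
  rw [hL1] at hweight hraise'
  rw [hL2, smul_smul, show -(1 / 2 : ℂ) * -2 = 1 by norm_num, one_smul] at hraise'
  refine ⟨g, hg, fun i => ?_⟩
  fin_cases i
  · change ∑ β ∈ _, c β • fockSpin β 0 p = fockSpin α 0 g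
    simp_rw [fockSpin_zero, LinearMap.smul_apply, LinearMap.add_apply, hraise', hlower,
      ← Finset.sum_add_distrib, Finset.smul_sum, ← smul_add, smul_comm (1 / 2 : ℂ)]
  · change ∑ β ∈ _, c β • fockSpin β 1 p = fockSpin α 1 g
    simp_rw [fockSpin_one, LinearMap.smul_apply, LinearMap.sub_apply, hraise', hlower,
      ← Finset.sum_sub_distrib, Finset.smul_sum, ← smul_sub, smul_comm (-Complex.I / 2)]
  · change ∑ β ∈ _, c β • fockSpin β 2 p = fockSpin α 2 g
    simp_rw [fockSpin_two, LinearMap.smul_apply, hweight, Finset.smul_sum, smul_comm (1 / 2 : ℂ)]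

end Transfer
/-! ### Lattice sums -/

section LatticeSums

theorem sub_one_mul_sum_range_mul_pow {R : Type*} [CommRing R] (t : R) (n : ℕ) :
    (t - 1) * ∑ k ∈ Finset.range n, (k : R) * t ^ k
      = n * t ^ n - t * ∑ k ∈ Finset.range n, t ^ k := by
  induction n with
  | zero => simp
  | succ n ih =>
    rw [Finset.sum_range_succ, Finset.sum_range_succ, mul_add, ih]
    push_cast
    ring

theorem sub_one_mul_sum_range_sq_mul_pow {R : Type*} [CommRing R] (t : R) (n : ℕ) :
    (t - 1) * ∑ k ∈ Finset.range n, (k : R) ^ 2 * t ^ k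
      = n ^ 2 * t ^ n - 2 * t * ∑ k ∈ Finset.range n, (k : R) * t ^ k
        - t * ∑ k ∈ Finset.range n, t ^ k := by
  induction n with
  | zero => simp
  | succ n ih =>
    rw [Finset.sum_range_succ, Finset.sum_range_succ, Finset.sum_range_succ, mul_add, ih]
    push_cast
    ring

section RootOfUnity

variable {K : Type*} [Field K] {t : K} {n : ℕ}

theorem sum_range_pow_eq_zero (ht : t ^ n = 1) (ht1 : t ≠ 1) :
    ∑ k ∈ Finset.range n, t ^ k = 0 := by
  rw [geom_sum_eq ht1, ht, sub_self, zero_div]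

theorem sum_range_mul_pow (ht : t ^ n = 1) (ht1 : t ≠ 1) :
    ∑ k ∈ Finset.range n, (k : K) * t ^ k = n * (t - 1)⁻¹ := by
  rw [eq_mul_inv_iff_mul_eq₀ (sub_ne_zero.mpr ht1), mul_comm, sub_one_mul_sum_range_mul_pow,
    sum_range_pow_eq_zero ht ht1, ht, mul_zero, sub_zero, mul_one]

theorem sum_range_sq_mul_pow (ht : t ^ n = 1) (ht1 : t ≠ 1) :
    ∑ k ∈ Finset.range n, (k : K) ^ 2 * t ^ k
      = (n ^ 2 - 2 * n) * (t - 1)⁻¹ - 2 * n * (t - 1)⁻¹ ^ 2 := by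
  have ht1' := sub_ne_zero.mpr ht1
  rw [← mul_right_inj' ht1', sub_one_mul_sum_range_sq_mul_pow, sum_range_mul_pow ht ht1,
    sum_range_pow_eq_zero ht ht1, ht]
  field

end RootOfUnity

section PowerSums

variable {K : Type*} [Field K] [CharZero K]

theorem sum_range_natCast (n : ℕ) : ∑ k ∈ Finset.range n, (k : K) = n * (n - 1) / 2 := by
  induction n with
  | zero => simp
  | succ n ih =>
    rw [Finset.sum_range_succ, ih]
    push_cast
    ring

theorem sum_range_natCast_sq (n : ℕ) :
    ∑ k ∈ Finset.range n, (k : K) ^ 2 = n * (n - 1) * (2 * n - 1) / 6 := by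
  induction n with
  | zero => simp
  | succ n ih =>
    rw [Finset.sum_range_succ, ih]
    push_cast
    ring

end PowerSums

variable {N : ℕ}

theorem eta_div_pow_card (α β : Fin N) : (eta α / eta β) ^ N = 1 := by
  rw [div_pow, eta_pow_card, eta_pow_card, div_one]

theorem eta_div_ne_one {α β : Fin N} (h : α ≠ β) : eta α / eta β ≠ 1 := by
  rw [Ne, div_eq_one_iff_eq (eta_ne_zero β)]
  exact eta_injective.ne h

theorem inv_eta_div_sub_one (α β : Fin N) :
    (eta α / eta β - 1)⁻¹ = eta β / (eta α - eta β) := by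
  rw [div_sub_one (eta_ne_zero β), inv_div]

/-- Summed over all sites `α`, every power of `η_α / η_β` other than the zeroth vanishes, so only
the term `α = β` is left over. -/
theorem sum_erase_sum_range_mul_eta_div_pow (β : Fin N) {a : ℕ → ℂ} (h0 : a 0 = 0) :
    ∑ α ∈ Finset.univ.erase β, ∑ k ∈ Finset.range N, a k * (eta α / eta β) ^ k
      = -∑ k ∈ Finset.range N, a k := by
  have hall : ∑ α : Fin N, ∑ k ∈ Finset.range N, a k * (eta α / eta β) ^ k = 0 := by
    rw [Finset.sum_comm]
    refine Finset.sum_eq_zero fun k hk => ?_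
    rcases Nat.eq_zero_or_pos k with rfl | hpos
    · simp [h0]
    · simp_rw [← Finset.mul_sum, div_pow, ← Finset.sum_div,
        sum_eta_pow hpos (Finset.mem_range.mp hk), zero_div, mul_zero]
  rw [← Finset.add_sum_erase _ _ (Finset.mem_univ β), div_self (eta_ne_zero β)] at hall
  simp_rw [one_pow, mul_one] at hall
  exact eq_neg_of_add_eq_zero_right hall

theorem sum_eta_div_sub (β : Fin N) :
    ∑ α ∈ Finset.univ.erase β, eta β / (eta α - eta β) = -(((N : ℂ) - 1) / 2) := by
  have hN : (N : ℂ) ≠ 0 := Nat.cast_ne_zero.mpr β.pos.ne'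
  have h := sum_erase_sum_range_mul_eta_div_pow β Nat.cast_zero
  rw [Finset.sum_congr rfl fun α hα => sum_range_mul_pow (eta_div_pow_card α β)
      (eta_div_ne_one (Finset.ne_of_mem_erase hα)),
    ← Finset.mul_sum, sum_range_natCast] at h
  simp_rw [inv_eta_div_sub_one] at h
  rw [← mul_right_inj' hN, h]
  ring

theorem sum_sq_eta_div_sub (β : Fin N) :
    ∑ α ∈ Finset.univ.erase β, (eta β / (eta α - eta β)) ^ 2 = ((N : ℂ) - 1) * (5 - N) / 12 := by
  have hN : (N : ℂ) ≠ 0 := Nat.cast_ne_zero.mpr β.pos.ne'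
  have h := sum_erase_sum_range_mul_eta_div_pow β (a := fun k => (k : ℂ) ^ 2) (by simp)
  rw [Finset.sum_congr rfl fun α hα => sum_range_sq_mul_pow (eta_div_pow_card α β)
      (eta_div_ne_one (Finset.ne_of_mem_erase hα)),
    Finset.sum_sub_distrib, ← Finset.mul_sum, ← Finset.mul_sum, sum_range_natCast_sq] at h
  simp_rw [inv_eta_div_sub_one] at h
  rw [sum_eta_div_sub] at h
  rw [← mul_right_inj' hN]
  linear_combination (-1 / 2 : ℂ) * h

theorem sum_eta_add_div_sub (β : Fin N) :
    ∑ α ∈ Finset.univ.erase β, (eta α + eta β) / (eta α - eta β) = 0 := by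
  have h : ∀ α ∈ Finset.univ.erase β,
      (eta α + eta β) / (eta α - eta β) = 1 + 2 * (eta β / (eta α - eta β)) := fun α hα => by
    have := eta_sub_ne_zero (Finset.ne_of_mem_erase hα)
    field
  rw [Finset.sum_congr rfl h, Finset.sum_add_distrib, ← Finset.mul_sum, sum_eta_div_sub,
    Finset.sum_const, nsmul_eq_mul, Finset.card_erase_of_mem (Finset.mem_univ β),
    Finset.card_univ, Fintype.card_fin, Nat.cast_pred β.pos]
  ring

/-- The factor `1 / (conj η_α - conj η_β)` of `omega α β γ`; it vanishes at `α = β`. -/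
def conjCoeff (α β : Fin N) : ℂ := 1 / (starRingEnd ℂ (eta α) - starRingEnd ℂ (eta β))

/-- The factor `1 / (η_α - η_γ)` of `omega α β γ`; it vanishes at `α = γ`. -/
def coeff (α γ : Fin N) : ℂ := 1 / (eta α - eta γ)

theorem omega_eq_mul (α β γ : Fin N) : omega α β γ = conjCoeff α β * coeff α γ := by
  rw [omega, conjCoeff, coeff, one_div_mul_one_div]

theorem omega_self_left (α γ : Fin N) : omega α α γ = 0 := by simp [omega]

theorem omega_self_right (α β : Fin N) : omega α β α = 0 := by simp [omega]

theorem omega_diag (α β : Fin N) : omega α β β = invDistSq α β := by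
  rw [omega, invDistSq, ← map_sub, mul_comm, Complex.mul_conj, Complex.normSq_eq_norm_sq,
    Complex.ofReal_div, Complex.ofReal_one]

theorem invDistSq_self (α : Fin N) : invDistSq α α = 0 := by simp [invDistSq]

theorem invDistSq_comm (α β : Fin N) : invDistSq α β = invDistSq β α := by
  rw [invDistSq, invDistSq, norm_sub_rev]

theorem conj_eta_sub_conj_eta (α β : Fin N) :
    starRingEnd ℂ (eta α) - starRingEnd ℂ (eta β) = -(eta α - eta β) / (eta α * eta β) := by
  have hα := eta_ne_zero α
  have hβ := eta_ne_zero β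
  rw [conj_eta, conj_eta]
  field

theorem conjCoeff_eq {α β : Fin N} (h : α ≠ β) :
    conjCoeff α β = -eta α ^ 2 * coeff α β + eta α := by
  have hα := eta_ne_zero α
  have hαβ := eta_sub_ne_zero h
  rw [conjCoeff, coeff, conj_eta_sub_conj_eta]
  field

theorem invDistSq_eq {α β : Fin N} (h : α ≠ β) :
    invDistSq α β = -(eta β / (eta α - eta β) + (eta β / (eta α - eta β)) ^ 2) := by
  have hβ := eta_ne_zero β
  have hαβ := eta_sub_ne_zero h
  rw [← omega_diag, omega, conj_eta_sub_conj_eta]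
  field

theorem sum_invDistSq (β : Fin N) : ∑ α, invDistSq α β = ((N : ℂ) ^ 2 - 1) / 12 := by
  rw [← Finset.add_sum_erase _ _ (Finset.mem_univ β), invDistSq_self, zero_add,
    Finset.sum_congr rfl fun α hα => invDistSq_eq (Finset.ne_of_mem_erase hα),
    Finset.sum_neg_distrib, Finset.sum_add_distrib, sum_eta_div_sub, sum_sq_eta_div_sub]
  ring

theorem omega_eq_mul_sub {α β γ : Fin N} (hβ : α ≠ β) (hγ : α ≠ γ) (h : β ≠ γ) :
    omega α β γ = -(eta β / (eta β - eta γ))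
      * (eta β / (eta α - eta β) - eta γ / (eta α - eta γ)) := by
  have hβ0 := eta_ne_zero β
  have hαβ := eta_sub_ne_zero hβ
  have hαγ := eta_sub_ne_zero hγ
  have hβγ := eta_sub_ne_zero h
  rw [omega, conj_eta_sub_conj_eta]
  field

theorem sum_omega {β γ : Fin N} (h : β ≠ γ) :
    ∑ α, omega α β γ = -(eta β * (eta β + eta γ)) / (eta β - eta γ) ^ 2 := by
  have hβγ := eta_sub_ne_zero h
  have hmem : γ ∈ Finset.univ.erase β := Finset.mem_erase.mpr ⟨h.symm, Finset.mem_univ γ⟩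
  have hβ := sum_eta_div_sub β
  have hγ := sum_eta_div_sub γ
  rw [← Finset.add_sum_erase _ _ hmem] at hβ
  rw [← Finset.add_sum_erase _ _ (Finset.mem_erase.mpr ⟨h, Finset.mem_univ β⟩),
    Finset.erase_right_comm] at hγ
  rw [← Finset.add_sum_erase _ _ (Finset.mem_univ β), omega_self_left, zero_add,
    ← Finset.add_sum_erase _ _ hmem, omega_self_right, zero_add,
    Finset.sum_congr rfl fun α hα =>
      omega_eq_mul_sub (Finset.ne_of_mem_erase (Finset.mem_of_mem_erase hα))
        (Finset.ne_of_mem_erase hα) h,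
    ← Finset.mul_sum, Finset.sum_sub_distrib, eq_sub_of_add_eq' hβ, eq_sub_of_add_eq' hγ,
    ← neg_sub (eta β) (eta γ)]
  field

theorem sum_omega_add_sum_omega (β γ : Fin N) :
    ∑ α, omega α β γ + ∑ α, omega α γ β
      = 4 * invDistSq β γ - 1 + if β = γ then ((N : ℂ) ^ 2 + 5) / 6 else 0 := by
  split_ifs with h
  · subst h
    simp_rw [omega_diag, sum_invDistSq, invDistSq_self]
    ring
  · have hβγ := eta_sub_ne_zero h
    rw [sum_omega h, sum_omega (Ne.symm h), invDistSq_eq h, ← neg_sub (eta β) (eta γ)]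
    field

end LatticeSums
/-! ### The vector operators of a spin chain -/

section WeightedSums

variable {N : ℕ} {M : Type*} [AddCommGroup M] [Module ℂ M]

theorem sum_erase_smul {ι : Type*} [Fintype ι] [DecidableEq ι] {α : ι} {c : ι → ℂ} (h : c α = 0)
    (f : ι → M) : ∑ β ∈ Finset.univ.erase α, c β • f β = ∑ β, c β • f β :=
  Finset.sum_erase _ (by rw [h, zero_smul])

theorem sum_sum_eta_add_div_sub_smul (f : Fin N → M) :
    ∑ α, ∑ β ∈ Finset.univ.erase α, ((eta α + eta β) / (eta α - eta β)) • f β = 0 := by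
  rw [Finset.sum_congr rfl fun α _ => sum_erase_smul
    (c := fun β => (eta α + eta β) / (eta α - eta β)) (by simp) f, Finset.sum_comm]
  refine Finset.sum_eq_zero fun β _ => ?_
  rw [← Finset.sum_smul, ← Finset.sum_erase (a := β) _ (by simp), sum_eta_add_div_sub, zero_smul]

theorem sum_sum_invDistSq_smul_right (f : Fin N → M) :
    ∑ α, ∑ β, invDistSq α β • f β = (((N : ℂ) ^ 2 - 1) / 12) • ∑ α, f α := by
  rw [Finset.sum_comm]
  simp_rw [← Finset.sum_smul, sum_invDistSq, Finset.smul_sum]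

theorem sum_sum_invDistSq_smul_left (f : Fin N → M) :
    ∑ α, ∑ β, invDistSq α β • f α = (((N : ℂ) ^ 2 - 1) / 12) • ∑ α, f α := by
  rw [Finset.sum_comm, ← sum_sum_invDistSq_smul_right]
  simp only [invDistSq_comm]

theorem sum_sum_invDistSq_smul_sub (g : Fin N → Fin N → M) :
    ∑ α, ∑ β, invDistSq α β • (g α β - g β α) = 0 := by
  simp_rw [smul_sub, Finset.sum_sub_distrib]
  rw [sub_eq_zero, Finset.sum_comm]
  simp_rw [invDistSq_comm]

theorem sum_erase_sum_erase_omega_smul (α : Fin N) (f : Fin N → Fin N → M) :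
    ∑ β ∈ Finset.univ.erase α, ∑ γ ∈ Finset.univ.erase α, omega α β γ • f β γ
      = ∑ β, ∑ γ, omega α β γ • f β γ := by
  rw [Finset.sum_erase _ (by simp [omega_self_left])]
  exact Finset.sum_congr rfl fun β _ => sum_erase_smul (omega_self_right α β) _

theorem sum_sum_sum_omega_smul {f : Fin N → Fin N → M} (hf : ∀ β γ, f β γ = f γ β) :
    ∑ α, ∑ β ∈ Finset.univ.erase α, ∑ γ ∈ Finset.univ.erase α, omega α β γ • f β γ
      = (2 : ℂ) • (∑ α, ∑ β ∈ Finset.univ.erase α, invDistSq α β • f α β)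
        - (1 / 2 : ℂ) • (∑ α, ∑ β, f α β) + (((N : ℂ) ^ 2 + 5) / 12) • ∑ α, f α α := by
  have hsum : ∑ α, ∑ β ∈ Finset.univ.erase α, ∑ γ ∈ Finset.univ.erase α, omega α β γ • f β γ
      = ∑ β, ∑ γ, (∑ α, omega α β γ) • f β γ := by
    simp_rw [sum_erase_sum_erase_omega_smul, Finset.sum_smul]
    rw [Finset.sum_comm]
    exact Finset.sum_congr rfl fun β _ => Finset.sum_comm
  have hswap : ∑ β, ∑ γ, (∑ α, omega α β γ) • f β γ = ∑ β, ∑ γ, (∑ α, omega α γ β) • f β γ := by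
    rw [Finset.sum_comm]
    simp_rw [hf]
  have hadd : ∑ β, ∑ γ, (∑ α, omega α β γ) • f β γ + ∑ β, ∑ γ, (∑ α, omega α γ β) • f β γ
      = (4 : ℂ) • (∑ β, ∑ γ, invDistSq β γ • f β γ) - ∑ β, ∑ γ, f β γ
        + (((N : ℂ) ^ 2 + 5) / 6) • ∑ β, f β β := by
    simp_rw [← Finset.sum_add_distrib, ← add_smul, sum_omega_add_sum_omega, add_smul, sub_smul,
      mul_smul, one_smul, ite_smul, zero_smul, Finset.sum_add_distrib, Finset.sum_sub_distrib,
      Finset.sum_ite_eq, Finset.mem_univ, if_true, Finset.smul_sum]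
  rw [← hswap] at hadd
  simp_rw [sum_erase_smul (invDistSq_self _)]
  rw [hsum]
  linear_combination (norm := module) (1 / 2 : ℂ) • hadd

theorem sum_add_sum_omega_smul_eq_add_sum_diag (a : ℂ) (e : Fin N → Fin N → M)
    (f g : Fin N → Fin N → Fin N → M) :
    ∑ α, ((∑ β ∈ Finset.univ.erase α, invDistSq α β • e α β)
        + ∑ β ∈ Finset.univ.erase α, ∑ γ ∈ Finset.univ.erase α,
          omega α β γ • (-(a • f α β γ) + g α β γ))
      = -(a • ∑ α, ∑ β ∈ Finset.univ.erase α, ∑ γ ∈ Finset.univ.erase α, omega α β γ • f α β γ)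
        + ∑ α, ∑ β ∈ Finset.univ.erase α, ∑ γ ∈ (Finset.univ.erase α).erase β,
          omega α β γ • g α β γ
        + ∑ α, ∑ β ∈ Finset.univ.erase α, invDistSq α β • (e α β + g α β β) := by
  have hdiag (α : Fin N) : ∑ β ∈ Finset.univ.erase α, ∑ γ ∈ Finset.univ.erase α,
        omega α β γ • g α β γ
      = ∑ β ∈ Finset.univ.erase α, invDistSq α β • g α β β
        + ∑ β ∈ Finset.univ.erase α, ∑ γ ∈ (Finset.univ.erase α).erase β,
          omega α β γ • g α β γ := by
    rw [← Finset.sum_add_distrib]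
    refine Finset.sum_congr rfl fun β hβ => ?_
    rw [← Finset.add_sum_erase _ _ hβ, omega_diag]
  simp_rw [smul_add, smul_neg, smul_comm (omega _ _ _) a, Finset.sum_add_distrib,
    Finset.sum_neg_distrib, ← Finset.smul_sum, hdiag, Finset.sum_add_distrib]
  abel

end WeightedSums

section VecSum

variable {ι R : Type*} [Fintype ι] [DecidableEq ι] [Ring R] [Algebra ℂ R]

/-- The vector operator `∑_{β ≠ α} c_β S_β`. The operators `D_α` and `A_α` are built from such
fields, see `opD_eq_topProj` and `opA_eq_quadField`. -/
def vecSum (S : ι → Fin 3 → R) (α : ι) (c : ι → ℂ) (i : Fin 3) : R :=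
  ∑ β ∈ Finset.univ.erase α, c β • S β i

theorem sum_smul_mul_sum_smul {κ μ : Type*} (s : Finset κ) (t : Finset μ) (c : κ → ℂ) (d : μ → ℂ)
    (f : κ → R) (g : μ → R) :
    (∑ i ∈ s, c i • f i) * ∑ j ∈ t, d j • g j = ∑ i ∈ s, ∑ j ∈ t, (c i * d j) • (f i * g j) := by
  simp_rw [Finset.sum_mul_sum, smul_mul_smul_comm]

variable (S : ι → Fin 3 → R) (α : ι) (c d : ι → ℂ)

theorem dot_vecSum (A : Fin 3 → R) :
    dot A (vecSum S α c) = ∑ β ∈ Finset.univ.erase α, c β • dot A (S β) := by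
  simp_rw [dot, vecSum, Finset.mul_sum, mul_smul_comm, Finset.smul_sum]
  exact Finset.sum_comm

theorem dot_vecSum_vecSum :
    dot (vecSum S α c) (vecSum S α d)
      = ∑ β ∈ Finset.univ.erase α, ∑ γ ∈ Finset.univ.erase α, (c β * d γ) • dot (S β) (S γ) := by
  simp_rw [dot, vecSum, sum_smul_mul_sum_smul, Finset.smul_sum]
  rw [Finset.sum_comm]
  exact Finset.sum_congr rfl fun β _ => Finset.sum_comm

theorem topProj_vecSum (s : ℂ) (A : Fin 3 → R) (i : Fin 3) :
    topProj s A (vecSum S α c) i = ∑ β ∈ Finset.univ.erase α, c β • topProj s A (S β) i := by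
  simp only [topProj, Pi.add_apply, Pi.sub_apply, Pi.smul_apply, dot_vecSum, cross, vecSum,
    Finset.mul_sum, mul_smul_comm, ← Finset.sum_sub_distrib, ← Finset.sum_add_distrib,
    Finset.smul_sum]
  refine Finset.sum_congr rfl fun β _ => ?_
  module

theorem quadField_vecSum (s : ℂ) (A : Fin 3 → R) (e : ι → ℂ) (i : Fin 3) :
    quadField s A (vecSum S α c) (vecSum S α d) (vecSum S α e) i
      = (∑ β ∈ Finset.univ.erase α, e β •
          (A i * dot A (S β) + dot A (S β) * A i + (2 * (s + 1)) • S β i))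
        + ∑ β ∈ Finset.univ.erase α, ∑ γ ∈ Finset.univ.erase α, (c β * d γ) •
          (-((1 / (s + 1)) •
              (dot A (S β) * A i * dot A (S γ) + dot A (S γ) * A i * dot A (S β)))
            + ((2 * (s + 2)) • (A i * dot (S β) (S γ)) - S β i * dot A (S γ)
              - dot A (S β) * S γ i)) := by
  have hfive (c d : ι → ℂ) : dot A (vecSum S α c) * A i * dot A (vecSum S α d)
      = ∑ β ∈ Finset.univ.erase α, ∑ γ ∈ Finset.univ.erase α,
        (c β * d γ) • (dot A (S β) * A i * dot A (S γ)) := by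
    simp_rw [dot_vecSum, Finset.sum_mul _ _ (A i), smul_mul_assoc _ _ (A i), sum_smul_mul_sum_smul]
  have hfive_swap : dot A (vecSum S α d) * A i * dot A (vecSum S α c)
      = ∑ β ∈ Finset.univ.erase α, ∑ γ ∈ Finset.univ.erase α,
        (c β * d γ) • (dot A (S γ) * A i * dot A (S β)) := by
    rw [hfive, Finset.sum_comm]
    simp_rw [mul_comm (d _)]
  rw [quadField, hfive, hfive_swap, dot_vecSum_vecSum]
  congr 1
  · simp only [dot_vecSum, vecSum, Finset.mul_sum, Finset.sum_mul, mul_smul_comm, smul_mul_assoc,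
      Finset.smul_sum, ← Finset.sum_add_distrib]
    refine Finset.sum_congr rfl fun β _ => ?_
    module
  · simp only [dot_vecSum, vecSum, sum_smul_mul_sum_smul]
    simp only [Finset.mul_sum, mul_smul_comm, Finset.smul_sum, ← Finset.sum_add_distrib,
      ← Finset.sum_neg_distrib, ← Finset.sum_sub_distrib]
    refine Finset.sum_congr rfl fun β _ => Finset.sum_congr rfl fun γ _ => ?_
    module

end VecSum

section IsSpinChain

variable {ι R : Type*} [Ring R] [Algebra ℂ R]

/-- A family of spins of quantum number `s`, any two of which commute. -/
structure IsSpinChain (s : ℂ) (S : ι → Fin 3 → R) : Prop where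
  isSpin : ∀ α, IsSpin s (S α)
  commute : ∀ α β, α ≠ β → ∀ i j, Commute (S α i) (S β j)

namespace IsSpinChain

variable {s : ℂ} {S : ι → Fin 3 → R}

theorem dot_comm (h : IsSpinChain s S) (α β : ι) : dot (S α) (S β) = dot (S β) (S α) := by
  by_cases hαβ : α = β
  · rw [hαβ]
  · exact Finset.sum_congr rfl fun i _ => (h.commute α β hαβ i i).eq

variable [Fintype ι] [DecidableEq ι]

theorem commute_vecSum (h : IsSpinChain s S) (α : ι) (c : ι → ℂ) (i j : Fin 3) :
    Commute (S α i) (vecSum S α c j) :=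
  Commute.sum_right _ _ _ fun β hβ =>
    (h.commute α β (Finset.ne_of_mem_erase hβ).symm i j).smul_right _

theorem vecSum_mul_sub_vecSum_mul (h : IsSpinChain s S) (α : ι) (c d : ι → ℂ) (i j : Fin 3) :
    vecSum S α c i * vecSum S α d j - vecSum S α d j * vecSum S α c i
      = ∑ β ∈ Finset.univ.erase α, (c β * d β) • (S β i * S β j - S β j * S β i) := by
  rw [vecSum, vecSum, sum_smul_mul_sum_smul, sum_smul_mul_sum_smul,
    Finset.sum_comm (f := fun γ β => (d γ * c β) • (S γ j * S β i)), ← Finset.sum_sub_distrib]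
  refine Finset.sum_congr rfl fun β hβ => ?_
  rw [← Finset.sum_sub_distrib, Finset.sum_eq_single_of_mem β hβ]
  · module
  · intro γ _ hγ
    rw [(h.commute γ β hγ j i).eq, mul_comm (d γ), sub_self]

theorem isVectorBracket_vecSum (h : IsSpinChain s S) (α : ι) (c d : ι → ℂ) :
    IsVectorBracket (vecSum S α c) (vecSum S α d) (vecSum S α fun β => c β * d β) where
  commute_same i := by
    rw [commute_iff_eq, ← sub_eq_zero, h.vecSum_mul_sub_vecSum_mul]
    simp
  bracket_pos i := by
    simp_rw [h.vecSum_mul_sub_vecSum_mul, (h.isSpin _).bracket_pos, vecSum, Finset.smul_sum,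
      smul_comm Complex.I]
  bracket_neg i := by
    simp_rw [h.vecSum_mul_sub_vecSum_mul, (h.isSpin _).bracket_neg, vecSum, Finset.smul_sum,
      smul_neg, Finset.sum_neg_distrib, smul_comm Complex.I]

variable {N : ℕ} {S : Fin N → Fin 3 → R}

theorem isVectorBracket_vecSum_omega (h : IsSpinChain s S) (α : Fin N) :
    IsVectorBracket (vecSum S α (conjCoeff α)) (vecSum S α (coeff α))
      (vecSum S α (invDistSq α)) := by
  have hdiag : invDistSq α = fun β => conjCoeff α β * coeff α β :=
    funext fun β => by rw [← omega_diag, omega_eq_mul]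
  exact hdiag ▸ h.isVectorBracket_vecSum α (conjCoeff α) (coeff α)

theorem sum_invDistSq_smul (h : IsSpinChain s S) (i : Fin 3) :
    ∑ α, ∑ β ∈ Finset.univ.erase α, invDistSq α β •
        (S α i * dot (S α) (S β) + dot (S α) (S β) * S α i + (2 * (s + 1)) • S β i
          + ((2 * (s + 2)) • (S α i * dot (S β) (S β)) - S β i * dot (S α) (S β)
            - dot (S α) (S β) * S β i))
      = ((s + 1) ^ 3 * (((N : ℂ) ^ 2 - 1) / 6)) • ∑ α, S α i := by
  set g : Fin N → Fin N → R := fun α β => S α i * dot (S α) (S β) + dot (S α) (S β) * S α i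
  have hsummand (α β : Fin N) :
      S α i * dot (S α) (S β) + dot (S α) (S β) * S α i + (2 * (s + 1)) • S β i
          + ((2 * (s + 2)) • (S α i * dot (S β) (S β)) - S β i * dot (S α) (S β)
            - dot (S α) (S β) * S β i)
        = g α β - g β α + ((2 * (s + 1)) • S β i + (2 * (s + 2) * (s * (s + 1))) • S α i) := by
    simp only [g, (h.isSpin β).casimir, h.dot_comm β α, mul_smul_comm, mul_one]
    module
  simp_rw [sum_erase_smul (invDistSq_self _), hsummand, smul_add, Finset.sum_add_distrib,
    sum_sum_invDistSq_smul_sub, smul_comm (invDistSq _ _) (_ : ℂ) (_ : R), ← Finset.smul_sum,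
    sum_sum_invDistSq_smul_left fun α => S α i, sum_sum_invDistSq_smul_right fun β => S β i]
  module

theorem dot_quadField_vecSum (h : IsSpinChain s S) (hs : s + 1 ≠ 0) (α : Fin N) :
    dot (S α) (quadField s (S α) (vecSum S α (conjCoeff α)) (vecSum S α (coeff α))
        (vecSum S α (invDistSq α)))
      = (2 * s * (s + 2)) • ∑ β ∈ Finset.univ.erase α, invDistSq α β • dot (S α) (S β)
        - (s * (s + 2) / (s + 1)) • ∑ β ∈ Finset.univ.erase α, ∑ γ ∈ Finset.univ.erase α,
          omega α β γ • (dot (S α) (S β) * dot (S α) (S γ) + dot (S α) (S γ) * dot (S α) (S β))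
        + (2 * s * (s + 1) * (s + 2)) • ∑ β ∈ Finset.univ.erase α,
          ∑ γ ∈ Finset.univ.erase α, omega α β γ • dot (S β) (S γ) := by
  rw [(h.isSpin α).dot_quadField (h.isVectorBracket_vecSum_omega α)
    (h.commute_vecSum α _) (h.commute_vecSum α _) (h.commute_vecSum α _) hs,
    dot_vecSum, dot_vecSum, dot_vecSum, dot_vecSum_vecSum, sum_smul_mul_sum_smul,
    sum_smul_mul_sum_smul, Finset.sum_comm (f := fun γ β => (coeff α γ * conjCoeff α β) • _)]
  simp_rw [mul_comm (coeff _ _), ← omega_eq_mul, smul_add (omega _ _ _), Finset.sum_add_distrib]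

theorem sum_omega_smul_dot (h : IsSpinChain s S) :
    ∑ α, ∑ β ∈ Finset.univ.erase α, ∑ γ ∈ Finset.univ.erase α, omega α β γ • dot (S β) (S γ)
      = (2 : ℂ) • (∑ α, ∑ β ∈ Finset.univ.erase α, invDistSq α β • dot (S α) (S β))
        - (1 / 2 : ℂ) • dot (fun i => ∑ α, S α i) (fun i => ∑ α, S α i)
        + ((N : ℂ) * ((N : ℂ) ^ 2 + 5) / 12 * (s * (s + 1))) • (1 : R) := by
  have htot : dot (fun i => ∑ α, S α i) (fun i => ∑ α, S α i) = ∑ β, ∑ γ, dot (S β) (S γ) := by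
    simp_rw [dot, Finset.sum_mul_sum]
    rw [Finset.sum_comm]
    exact Finset.sum_congr rfl fun β _ => Finset.sum_comm
  have hself : ∑ α, dot (S α) (S α) = ((N : ℂ) * (s * (s + 1))) • (1 : R) := by
    simp_rw [fun α => (h.isSpin α).casimir, Finset.sum_const, Finset.card_univ, Fintype.card_fin,
      ← Nat.cast_smul_eq_nsmul ℂ, smul_smul]
  rw [sum_sum_sum_omega_smul h.dot_comm, htot, hself]
  module

theorem smul_sum_dot_quadField (h : IsSpinChain s S) (hs0 : s ≠ 0) (hs1 : s + 1 ≠ 0)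
    (hs2 : s + 2 ≠ 0) (hs3 : 2 * s + 3 ≠ 0) (a : ℂ) :
    a • ((1 / (2 * s * (s + 2) * (2 * s + 3))) •
          (∑ α, dot (S α) (quadField s (S α) (vecSum S α (conjCoeff α)) (vecSum S α (coeff α))
            (vecSum S α (invDistSq α))))
        + ((s + 1) / (2 * (2 * s + 3))) • dot (fun i => ∑ α, S α i) (fun i => ∑ α, S α i))
      = a • ((∑ α, ∑ β ∈ Finset.univ.erase α, invDistSq α β • dot (S α) (S β))
          - (1 / (2 * (s + 1) * (2 * s + 3))) •
            ∑ α, ∑ β ∈ Finset.univ.erase α, ∑ γ ∈ Finset.univ.erase α, omega α β γ •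
              (dot (S α) (S β) * dot (S α) (S γ) + dot (S α) (S γ) * dot (S α) (S β)))
        - (-a * (s * (s + 1) ^ 2 / (2 * s + 3)) * ((N : ℂ) * ((N : ℂ) ^ 2 + 5) / 12)) •
          (1 : R) := by
  simp_rw [h.dot_quadField_vecSum hs1, Finset.sum_add_distrib, Finset.sum_sub_distrib,
    ← Finset.smul_sum, h.sum_omega_smul_dot]
  match_scalars <;> field_simp <;> ring

end IsSpinChain

end IsSpinChain

section SpinOperators

variable {N k : ℕ}

theorem isSpinChain_spin : IsSpinChain (qn k) (spin (N := N) (k := k)) where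
  isSpin α :=
    { commute_same i := Commute.refl _
      bracket_pos i := LinearMap.ext fun p =>
        Subtype.ext (LinearMap.congr_fun ((isVectorBracket_fockSpin α).bracket_pos i) p.1)
      bracket_neg i := LinearMap.ext fun p =>
        Subtype.ext (LinearMap.congr_fun ((isVectorBracket_fockSpin α).bracket_neg i) p.1)
      casimir := LinearMap.ext fun p => Subtype.ext <| by
        simpa [dot, spin, qn] using dot_fockSpin_apply (mem_spinSpace.mp p.2 α) }
  commute _ _ h i j := LinearMap.ext fun p =>
    Subtype.ext (LinearMap.congr_fun (commute_fockSpin h i j).eq p.1)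

theorem qn_add_natCast_ne_zero (k : ℕ) {m : ℕ} (hm : 0 < m) : qn k + m ≠ 0 := by
  have h : (k : ℂ) + 2 * m ≠ 0 := by exact_mod_cast (by lia : k + 2 * m ≠ 0)
  rw [qn]
  exact fun h0 => h (by linear_combination 2 * h0)

theorem opD_eq_topProj (α : Fin N) (i : Fin 3) :
    opD (k := k) α i = (1 / 2 : ℂ) • topProj (qn k) (spin α)
      (vecSum spin α fun β => (eta α + eta β) / (eta α - eta β)) i := by
  rw [topProj_vecSum]
  rfl

theorem opA_eq_quadField (α : Fin N) :
    opA (k := k) α = quadField (qn k) (spin α) (vecSum spin α (conjCoeff α))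
      (vecSum spin α (coeff α)) (vecSum spin α (invDistSq α)) := by
  funext i
  simp_rw [quadField_vecSum, ← omega_eq_mul]
  rfl

theorem sum_opD (i : Fin 3) : ∑ α : Fin N, opD (k := k) α i = opLambda i := by
  have h (α : Fin N) : opD (k := k) α i = (1 / 2 : ℂ) • (∑ β ∈ Finset.univ.erase α,
        ((eta α + eta β) / (eta α - eta β)) •
          (Complex.I • cross (spin α) (spin β) i - (1 / (qn k + 1)) • (spin α i * spinDot α β))
      + (qn k + 1) • ∑ β ∈ Finset.univ.erase α,
        ((eta α + eta β) / (eta α - eta β)) • spin β i) := by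
    rw [opD, Finset.smul_sum (r := qn k + 1), ← Finset.sum_add_distrib]
    congr 1
    refine Finset.sum_congr rfl fun β _ => ?_
    module
  simp_rw [h, ← Finset.smul_sum, Finset.sum_add_distrib, ← Finset.smul_sum,
    sum_sum_eta_add_div_sub_smul (fun β => spin β i), smul_zero, add_zero]
  rfl

theorem sum_opA (i : Fin 3) :
    ∑ α : Fin N, opA (k := k) α i
      = opUpsilon i + ((qn k + 1) ^ 3 * (((N : ℂ) ^ 2 - 1) / 6)) • totalSpin i :=
  (sum_add_sum_omega_smul_eq_add_sum_diag (1 / (qn k + 1))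
    (fun α β => spin α i * spinDot α β + spinDot α β * spin α i + (2 * (qn k + 1)) • spin β i)
    (fun α β γ => fiveSpin α β γ i) (fun α β γ => threeSpin α β γ i)).trans
    (congrArg (opUpsilon i + ·) (isSpinChain_spin.sum_invDistSq_smul i))

theorem parent_hamiltonian_eq (hk : 0 < k) :
    (2 * (Real.pi : ℂ) ^ 2 / (N : ℂ) ^ 2) •
        ((1 / (2 * qn k * (qn k + 2) * (2 * qn k + 3))) •
          (∑ α : Fin N, dot (spin (k := k) α) (opA α))
        + ((qn k + 1) / (2 * (2 * qn k + 3))) • dot (totalSpin (N := N)) totalSpin)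
      = hamiltonian N k - groundEnergy N k • (1 : Module.End ℂ (SpinSpace N k)) := by
  have hs0 : qn k ≠ 0 := div_ne_zero (Nat.cast_ne_zero.mpr hk.ne') two_ne_zero
  have hs1 : qn k + 1 ≠ 0 := by exact_mod_cast qn_add_natCast_ne_zero k one_pos
  have hs2 : qn k + 2 ≠ 0 := by exact_mod_cast qn_add_natCast_ne_zero k two_pos
  have hs3 : 2 * qn k + 3 ≠ 0 := by
    rw [qn, mul_div_cancel₀ _ two_ne_zero]
    exact_mod_cast (k + 2).succ_ne_zero
  simp_rw [opA_eq_quadField]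
  exact isSpinChain_spin.smul_sum_dot_quadField hs0 hs1 hs2 hs3 _

end SpinOperators

/-! ### Annihilation of the ground state -/

section GroundState

variable {N k : ℕ} {α : Fin N}

/-- The weighted sum of spins `∑_{β ≠ α} c_β S_β` acts on the Haldane–Shastry state like the spin
at `α` acts on some vector with one boson at `α`. -/
def ActsLocally (α : Fin N) (c : Fin N → ℂ) : Prop :=
  ∃ g, bosonNumber α g = g ∧ ∀ i,
    ∑ β ∈ Finset.univ.erase α, c β • fockSpin β i (hsPoly N) = fockSpin α i g

theorem ActsLocally.combination {c d e : Fin N → ℂ} (hc : ActsLocally α c) (hd : ActsLocally α d)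
    (a b : ℂ) (he : ∀ β, β ≠ α → e β = a * c β + b * d β) : ActsLocally α e := by
  obtain ⟨g, hg, hgc⟩ := hc
  obtain ⟨h, hh, hhd⟩ := hd
  refine ⟨a • g + b • h, by simp only [map_add, map_smul, hg, hh], fun i => ?_⟩
  rw [map_add, map_smul, map_smul, ← hgc, ← hhd, Finset.smul_sum, Finset.smul_sum,
    ← Finset.sum_add_distrib]
  refine Finset.sum_congr rfl fun β hβ => ?_
  rw [he β (Finset.ne_of_mem_erase hβ)]
  module

theorem actsLocally_one (hN : Even N) (hN2 : 2 ≤ N) (α : Fin N) : ActsLocally α fun _ => 1 := by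
  refine ⟨-hsPoly N, by rw [map_neg, bosonNumber_hsPoly], fun i => ?_⟩
  have h := sum_fockSpin_hsPoly hN hN2 i
  rw [← Finset.add_sum_erase _ _ (Finset.mem_univ α)] at h
  simp_rw [one_smul]
  rw [eq_neg_of_add_eq_zero_right h, map_neg]

theorem actsLocally_coeff (hN : Even N) (hN2 : 2 ≤ N) (α : Fin N) : ActsLocally α (coeff α) :=
  exists_fockSpin_eq_sum (bosonNumber_hsPoly α) (raiseTot_hsPoly hN hN2) _
    (pderiv_sum_lower_hsPoly hN2 α)

theorem actsLocally_conjCoeff (hN : Even N) (hN2 : 2 ≤ N) (α : Fin N) :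
    ActsLocally α (conjCoeff α) :=
  (actsLocally_coeff hN hN2 α).combination (actsLocally_one hN hN2 α) (-eta α ^ 2) (eta α)
    fun β hβ => by rw [conjCoeff_eq hβ.symm, mul_one]

theorem actsLocally_eta_add_div_sub (hN : Even N) (hN2 : 2 ≤ N) (α : Fin N) :
    ActsLocally α fun β => (eta α + eta β) / (eta α - eta β) :=
  (actsLocally_coeff hN hN2 α).combination (actsLocally_one hN hN2 α) (2 * eta α) (-1)
    fun β hβ => by
      have := eta_sub_ne_zero hβ.symm
      rw [coeff]
      field_simp
      ring

theorem coe_vecSum_groundState {c : Fin N → ℂ} {g : Fock N}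
    (hg : ∀ i, ∑ β ∈ Finset.univ.erase α, c β • fockSpin β i (hsPoly N) = fockSpin α i g)
    (i : Fin 3) :
    (vecSum spin α c i (groundState N k)).1
      = hsPoly N ^ (k - 1) * fockSpin α i ((k : ℂ) • g) := by
  have hspin (β : Fin N) : (spin β i (groundState N k)).1
      = (k : ℂ) • (hsPoly N ^ (k - 1) * fockSpin β i (hsPoly N)) :=
    (fockSpin_pow β i (hsPoly N) k).trans (Nat.cast_smul_eq_nsmul ℂ _ _).symm
  rw [vecSum, LinearMap.sum_apply, Submodule.coe_sum, map_smul, ← hg, mul_smul_comm,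
    Finset.mul_sum, Finset.smul_sum]
  refine Finset.sum_congr rfl fun β _ => ?_
  rw [LinearMap.smul_apply, Submodule.coe_smul, hspin, mul_smul_comm, smul_comm]

theorem topProj_groundState (hk : 0 < k) {c : Fin N → ℂ} (hc : ActsLocally α c) (i : Fin 3) :
    topProj (qn k) (spin α) (vecSum spin α c) i (groundState N k) = 0 := by
  obtain ⟨g, hg, hgc⟩ := hc
  have hkg : bosonNumber α ((k : ℂ) • g) = (k : ℂ) • g := by rw [map_smul, hg]
  have h := topProj_pow_mul_eq_zero (bosonNumber_hsPoly α) hkg (Nat.sub_add_cancel hk).symm i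
  simp only [← coe_vecSum_groundState hgc, map_sum] at h
  refine Subtype.ext (Eq.trans ?_ h)
  simp [topProj, cross, dot, spin]

theorem opD_groundState (hN : Even N) (hN2 : 2 ≤ N) (hk : 0 < k) (α : Fin N) (i : Fin 3) :
    opD α i (groundState N k) = 0 := by
  rw [opD_eq_topProj, LinearMap.smul_apply,
    topProj_groundState hk (actsLocally_eta_add_div_sub hN hN2 α), smul_zero]

theorem opA_groundState (hN : Even N) (hN2 : 2 ≤ N) (hk : 0 < k) (α : Fin N) (i : Fin 3) :
    opA α i (groundState N k) = 0 := by
  have hU := topProj_groundState hk (actsLocally_conjCoeff hN hN2 α)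
  have hW := topProj_groundState hk (actsLocally_coeff hN hN2 α)
  have hspin := isSpinChain_spin (N := N) (k := k)
  rw [opA_eq_quadField, (hspin.isSpin α).quadField_eq (hspin.isVectorBracket_vecSum_omega α)
    (hspin.commute_vecSum α _) (hspin.commute_vecSum α _) (hspin.commute_vecSum α _)]
  simp [dot, cross, hU, hW]

theorem totalSpin_groundState (hN : Even N) (hN2 : 2 ≤ N) (i : Fin 3) :
    totalSpin i (groundState N k) = 0 := by
  refine Subtype.ext ?_
  rw [totalSpin, LinearMap.sum_apply, Submodule.coe_sum]
  refine (Finset.sum_congr rfl fun β _ => fockSpin_pow β i (hsPoly N) k).trans ?_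
  rw [← Finset.smul_sum, ← Finset.mul_sum, sum_fockSpin_hsPoly hN hN2, mul_zero, smul_zero]
  rfl

theorem opLambda_groundState (hN : Even N) (hN2 : 2 ≤ N) (hk : 0 < k) (i : Fin 3) :
    opLambda i (groundState N k) = 0 := by
  rw [← sum_opD, LinearMap.sum_apply]
  exact Finset.sum_eq_zero fun α _ => opD_groundState hN hN2 hk α i

theorem opUpsilon_groundState (hN : Even N) (hN2 : 2 ≤ N) (hk : 0 < k) (i : Fin 3) :
    opUpsilon i (groundState N k) = 0 := by
  have hsum := LinearMap.congr_fun (sum_opA (k := k) i) (groundState N k)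
  rw [LinearMap.sum_apply, Finset.sum_eq_zero fun α _ => opA_groundState hN hN2 hk α i,
    LinearMap.add_apply, LinearMap.smul_apply, totalSpin_groundState hN hN2, smul_zero,
    add_zero] at hsum
  exact hsum.symm

end GroundState

end SpinChain

end

theorem mainTheorem4 (N k : ℕ) (hN : Even N) (hN0 : 0 < N) (hk : 0 < k) :
    (∀ (α : Fin N) (i : Fin 3), SpinChain.opD α i (SpinChain.groundState N k) = 0) ∧
    (∀ (α : Fin N) (i : Fin 3), SpinChain.opA α i (SpinChain.groundState N k) = 0) ∧
    (∀ i : Fin 3,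
      ∑ α : Fin N, SpinChain.opD (k := k) α i = SpinChain.opLambda (N := N) i) ∧
    (∀ i : Fin 3, SpinChain.opLambda i (SpinChain.groundState N k) = 0) ∧
    (∀ i : Fin 3,
      ∑ α : Fin N, SpinChain.opA (k := k) α i
        = SpinChain.opUpsilon (N := N) i
          + ((SpinChain.qn k + 1) ^ 3 * (((N : ℂ) ^ 2 - 1) / 6)) •
            SpinChain.totalSpin (N := N) i) ∧
    (∀ i : Fin 3, SpinChain.opUpsilon i (SpinChain.groundState N k) = 0) ∧
    (2 * (Real.pi : ℂ) ^ 2 / (N : ℂ) ^ 2) •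
        ((1 / (2 * SpinChain.qn k * (SpinChain.qn k + 2) * (2 * SpinChain.qn k + 3))) •
          (∑ α : Fin N, SpinChain.dot (SpinChain.spin (k := k) α) (SpinChain.opA α))
        + ((SpinChain.qn k + 1) / (2 * (2 * SpinChain.qn k + 3))) •
          SpinChain.dot (SpinChain.totalSpin (N := N)) SpinChain.totalSpin)
      = SpinChain.hamiltonian N k
        - SpinChain.groundEnergy N k • (1 : Module.End ℂ (SpinChain.SpinSpace N k)) := by
  have hN2 : 2 ≤ N := Nat.le_of_dvd hN0 hN.two_dvd
  exact ⟨SpinChain.opD_groundState hN hN2 hk, SpinChain.opA_groundState hN hN2 hk,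
    SpinChain.sum_opD, SpinChain.opLambda_groundState hN hN2 hk, SpinChain.sum_opA,
    SpinChain.opUpsilon_groundState hN hN2 hk, SpinChain.parent_hamiltonian_eq hk⟩
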